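/- Let $X_1,X_2,\dots$ be i.i.d. random variables with values in $[0,\infty)$ whose distribution function $F$ is continuous and has first and second derivatives $f=F'$ and $f'=F''$ that exist, are continuous and are bounded on $[0,\infty)$ (one-sided derivatives at $0$). For $m,n\in\{1,2,\dots\}$ and $x\ge 0$ let $$F_n(x)=\frac1n\sum_{i=1}^n \mathbb I(X_i\le x),\qquad \hat F^S_{m,n}(x)=\sum_{k=0}^\infty F_n\!\left(\frac km\right)e^{-mx}\frac{(mx)^k}{k!}$$ be the empirical distribution function (EDF) and the Szasz estimator. Fix $a>0$ and, for an estimator $G$ of $F$, put $$\mathrm{MSE}[G(x)]=\mathbb E\big[(G(x)-F(x))^2\big],\qquad \mathrm{MISE}[G]=\mathbb E\Big[\int_0^\infty (G(x)-F(x))^2e^{-ax}f(x)\,dx\Big].$$ Let $$i^S_L(n,x)=\min\{k\ge1:\mathrm{MSE}[F_k(x)]\le \mathrm{MSE}[\hat F^S_{m,n}(x)]\},\qquad i^S_G(n)=\min\{k\ge1:\mathrm{MISE}[F_k]\le \mathrm{MISE}[\hat F^S_{m,n}]\}$$ (both minima exist for all large $n$ in the situations below). Put $$\sigma^2(x)=F(x)(1-F(x)),\quad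 V^S(x)=f(x)\Big[\frac x\pi\Big]^{1/2},\quad b^S(x)=\frac{x f'(x)}2,\quad \theta^S(x)=\frac{V^S(x)}{\sigma^2(x)},\quad \gamma^S(x)=\frac{(b^S(x))^2}{\sigma^2(x)},$$ $$C_1^S=\int_0^\infty\sigma^2(x)e^{-ax}f(x)\,dx,\quad C_2^S=\int_0^\infty V^S(x)e^{-ax}f(x)\,dx,\quad C_3^S=\int_0^\infty (b^S(x))^2e^{-ax}f(x)\,dx.$$ **Theorem.** Let $m=m(n)$ be a sequence of positive integers with $m\to\infty$ as $n\to\infty$. Below, $x$ is any point of $(0,\infty)$ with $0<F(x)<1$, and $o_x(1)$ denotes a quantity that tends to $0$ as $n\to\infty$ for each fixed such $x$. If $mn^{-1/2}\to\infty$, then $$i_L^S(n,x)=n[1+o_x(1)]\quad\text{and}\quad i_G^S(n)=n[1+o(1)].$$ In addition: (a) If $mn^{-2/3}\to\infty$ and $mn^{-2}\to0$, then $$i_L^S(n,x)-n=m^{-1/2}n[\theta^S(x)+o_x(1)]\quad\text{and}\quad i_G^S(n)-n=m^{-1/2}n[C_2^S/C_1^S+o(1)].$$ (b) If $mn^{-2/3}\to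 c$ for a constant $c>0$, then $$i_L^S(n,x)-n=n^{2/3}[c^{-1/2}\theta^S(x)-c^{-2}\gamma^S(x)+o_x(1)]$$ and $$i_G^S(n)-n=n^{2/3}[c^{-1/2}C_2^S/C_1^S-c^{-2}C_3^S/C_1^S+o(1)].$$ -/

import Mathlib

open MeasureTheory ProbabilityTheory Filter Topology Set

noncomputable section

namespace SzaszEDF

variable {Ω : Type*}

/-- The empirical distribution function
`F_n(x) = n⁻¹ ∑_{i < n} 1{X_i ≤ x}` of the first `n` observations (used for `n ≥ 1`). -/
def edf (X : ℕ → Ω → ℝ) (n : ℕ) (ω : Ω) (x : ℝ) : ℝ :=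
  (1 / (n : ℝ)) * ∑ i ∈ Finset.range n, (Set.Iic x).indicator (fun _ => (1 : ℝ)) (X i ω)

/-- The Poisson weight `V_{k,m}(x) = e^{-mx} (mx)^k / k!`. -/
def poissonWeight (k m : ℕ) (x : ℝ) : ℝ :=
  Real.exp (-((m : ℝ) * x)) * ((m : ℝ) * x) ^ k / (k.factorial : ℝ)

/-- The Szasz estimator `∑_{k ≥ 0} F_n(k/m) V_{k,m}(x)`. The series converges absolutely, because
`F_n` is bounded by one and the Poisson weights are summable. -/
def szasz (X : ℕ → Ω → ℝ) (m n : ℕ) (ω : Ω) (x : ℝ) : ℝ :=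
  ∑' k : ℕ, edf X n ω ((k : ℝ) / (m : ℝ)) * poissonWeight k m x

variable [MeasurableSpace Ω]

/-- The mean squared error at `x` of an estimator `G` of the function `F`. -/
def mse (P : Measure Ω) (F : ℝ → ℝ) (G : Ω → ℝ → ℝ) (x : ℝ) : ℝ :=
  ∫ ω, (G ω x - F x) ^ 2 ∂P

/-- The mean integrated squared error of an estimator `G` of the function `F` on the half line,
with the weight function `e^{-ax} f(x)`. -/
def mise (P : Measure Ω) (F f : ℝ → ℝ) (a : ℝ) (G : Ω → ℝ → ℝ) : ℝ :=
  ∫ ω, (∫ x in Set.Ioi (0 : ℝ), (G ω x - F x) ^ 2 * (Real.exp (-(a * x)) * f x)) ∂P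

/-- The local number `i_L(n, x)`: the least sample size `k ≥ 1` for which the EDF has at `x` an MSE
not larger than that of the Szasz estimator with parameters `m, n`. The value is `0` exactly when
there is no such `k`. -/
def iL (P : Measure Ω) (X : ℕ → Ω → ℝ) (F : ℝ → ℝ) (m n : ℕ) (x : ℝ) : ℕ :=
  sInf {k : ℕ | 1 ≤ k ∧ mse P F (edf X k) x ≤ mse P F (szasz X m n) x}

/-- The global number `i_G(n)`: the least sample size `k ≥ 1` for which the EDF has a MISE not
larger than that of the Szasz estimator with parameters `m, n`. The value is `0` exactly when
there is no such `k`. -/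
def iG (P : Measure Ω) (X : ℕ → Ω → ℝ) (F f : ℝ → ℝ) (a : ℝ) (m n : ℕ) : ℕ :=
  sInf {k : ℕ | 1 ≤ k ∧ mise P F f a (edf X k) ≤ mise P F f a (szasz X m n)}

/-- `σ²(x) = F(x) (1 - F(x))`. -/
def sigmaSq (F : ℝ → ℝ) (x : ℝ) : ℝ := F x * (1 - F x)

/-- `V(x) = f(x) (x/π)^{1/2}`. -/
def VS (f : ℝ → ℝ) (x : ℝ) : ℝ := f x * Real.sqrt (x / Real.pi)

/-- `b(x) = x f'(x) / 2`. -/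
def bS (f' : ℝ → ℝ) (x : ℝ) : ℝ := x * f' x / 2

/-- `θ(x) = V(x) / σ²(x)`. -/
def thetaS (F f : ℝ → ℝ) (x : ℝ) : ℝ := VS f x / sigmaSq F x

/-- `γ(x) = b(x)² / σ²(x)`. -/
def gammaS (F f' : ℝ → ℝ) (x : ℝ) : ℝ := bS f' x ^ 2 / sigmaSq F x

/-- `C₁ = ∫₀^∞ σ²(x) e^{-ax} f(x) dx`. -/
def C1 (F f : ℝ → ℝ) (a : ℝ) : ℝ :=
  ∫ x in Set.Ioi (0 : ℝ), sigmaSq F x * (Real.exp (-(a * x)) * f x)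

/-- `C₂ = ∫₀^∞ V(x) e^{-ax} f(x) dx`. -/
def C2 (f : ℝ → ℝ) (a : ℝ) : ℝ :=
  ∫ x in Set.Ioi (0 : ℝ), VS f x * (Real.exp (-(a * x)) * f x)

/-- `C₃ = ∫₀^∞ b(x)² e^{-ax} f(x) dx`. -/
def C3 (f f' : ℝ → ℝ) (a : ℝ) : ℝ :=
  ∫ x in Set.Ioi (0 : ℝ), bS f' x ^ 2 * (Real.exp (-(a * x)) * f x)

/-- `u(n) = r(n) [ℓ + o(1)]` as `n → ∞`. -/
def EqTimesAddLittleO (u r : ℕ → ℝ) (ℓ : ℝ) : Prop :=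
  ∃ ε : ℕ → ℝ, Tendsto ε atTop (𝓝 0) ∧ ∀ᶠ n in atTop, u n = r n * (ℓ + ε n)

end SzaszEDF

end

/-! Let `K`, `K'` be independent Poisson variables of mean `m x`. The Szasz estimator is the sample
mean of the kernel `t ↦ P(t ≤ K/m)`, so its MSE is exactly variance over `n` plus squared bias. By
Fubini the kernel has mean `E F(K/m)` and second moment `E F(min(K, K')/m)`.

Bias: since `E K/m = x` and `Var(K/m) = x/m`, a second-order Taylor expansion gives `m (E F(K/m) - F
x) → b(x)` (`tendsto_mul_poissonMean_sub`). Variance: `min(K, K') = (K + K' - |K - K'|)/2`, and `E|K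
- K'| ~ 2 √(m x/π)`, so a first-order expansion gives `√m (F x - E F(min(K, K')/m)) → V(x)`;
replacing `(E F(K/m))²` by `F(x)²` costs only `O(1/m)`. The mean absolute difference is computed by
Fourier analysis: `π |j|` is the integral over `(0, π)` of a Fejér kernel, which turns the
expectation into an integral of the Poisson characteristic function, evaluated asymptotically by
rescaling.

Hence the MSE equals `(s - m^(-1/2) v_m)/n + β_m/m²` with `s = σ²`, `v_m → V`, `β_m → b²`. The MISE
has the same shape with limits `C1`, `C2`, `C3`, by dominated convergence with bounds polynomial in
`x`. The EDF of size `k` has error `s/k`, so the matching size is `⌈n/δ⌉` with `δ = 1 - m^(-1/2)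
v_m/s + (n/m²) β_m/s`. The three regimes follow by comparing `m^(-1/2)`, `n/m²` and the rounding
error (`matching_asymptotics`), once for the local and once for the global problem. -/

namespace SzaszEDF
open scoped NNReal Nat

/-! ### Moments of the Poisson distribution -/

/-- The Stein–Chen shift identity for Poisson weighted sums. -/
lemma hasSum_poisson_shift (r : ℝ≥0) (g : ℕ → ℝ) (S : ℝ)
    (h : HasSum (fun n : ℕ => Real.exp (-r) * r ^ n / (n)! * g (n + 1)) S) :
    HasSum (fun n : ℕ => Real.exp (-r) * r ^ n / (n)! * (n * g n)) (r * S) := by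
  rw [← hasSum_nat_add_iff' 1]
  simp only [Finset.range_one, Finset.sum_singleton, Nat.cast_zero, zero_mul, mul_zero, sub_zero]
  refine (h.mul_left (r : ℝ)).congr_fun fun n => ?_
  rw [Nat.factorial_succ]
  push_cast
  have : (n : ℝ) + 1 ≠ 0 := by positivity
  field_simp
  ring

lemma hasSum_poisson_zero (r : ℝ≥0) :
    HasSum (fun n : ℕ => Real.exp (-r) * r ^ n / (n)! * (1 : ℝ)) 1 := by
  simpa using hasSum_one_poissonMeasure r

lemma hasSum_poisson_one (r : ℝ≥0) :
    HasSum (fun n : ℕ => Real.exp (-r) * r ^ n / (n)! * (n : ℝ)) r := by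
  simpa using hasSum_poisson_shift r (fun _ => 1) 1 (hasSum_poisson_zero r)

lemma hasSum_poisson_two (r : ℝ≥0) :
    HasSum (fun n : ℕ => Real.exp (-r) * r ^ n / (n)! * (n : ℝ) ^ 2) (r * (r + 1)) := by
  have := hasSum_poisson_shift r (fun n => n) (r + 1)
    (((hasSum_poisson_one r).add (hasSum_poisson_zero r)).congr_fun fun n => by
      push_cast; ring)
  exact this.congr_fun fun n => by ring

lemma hasSum_poisson_three (r : ℝ≥0) :
    HasSum (fun n : ℕ => Real.exp (-r) * r ^ n / (n)! * (n : ℝ) ^ 3)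
      (r * (r * (r + 1) + (2 * r + 1))) := by
  have := hasSum_poisson_shift r (fun n => n ^ 2) (r * (r + 1) + (2 * r + 1))
    (((hasSum_poisson_two r).add (((hasSum_poisson_one r).mul_left 2).add
      (hasSum_poisson_zero r))).congr_fun fun n => by push_cast; ring)
  exact this.congr_fun fun n => by ring

lemma hasSum_poisson_four (r : ℝ≥0) :
    HasSum (fun n : ℕ => Real.exp (-r) * r ^ n / (n)! * (n : ℝ) ^ 4)
      (r * (r * (r * (r + 1) + (2 * r + 1)) + (3 * (r * (r + 1)) + (3 * r + 1)))) := by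
  have := hasSum_poisson_shift r (fun n => n ^ 3)
    (r * (r * (r + 1) + (2 * r + 1)) + (3 * (r * (r + 1)) + (3 * r + 1)))
    (((hasSum_poisson_three r).add (((hasSum_poisson_two r).mul_left 3).add
      (((hasSum_poisson_one r).mul_left 3).add
      (hasSum_poisson_zero r)))).congr_fun fun n => by push_cast; ring)
  exact this.congr_fun fun n => by ring

lemma integral_poisson_of_hasSum {r : ℝ≥0} {g : ℕ → ℝ} {S : ℝ}
    (h : HasSum (fun n : ℕ => Real.exp (-r) * r ^ n / (n)! * g n) S) :
    ∫ n, g n ∂(poissonMeasure r) = S := by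
  rw [integral_poissonMeasure]
  exact h.tsum_eq

lemma integrable_poisson_of_hasSum {r : ℝ≥0} {g : ℕ → ℝ} {S : ℝ} 
    (h : HasSum (fun n : ℕ => Real.exp (-r) * r ^ n / (n)! * g n) S) :
    Integrable g (poissonMeasure r) := by
  rw [integrable_poissonMeasure_iff]
  refine h.summable.norm.congr fun n => ?_
  rw [norm_mul, Real.norm_of_nonneg (by positivity)]

lemma hasSum_poisson_sub (r : ℝ≥0) :
    HasSum (fun n : ℕ => Real.exp (-r) * r ^ n / (n)! * ((n : ℝ) - r)) 0 := by
  have := (hasSum_poisson_one r).add ((hasSum_poisson_zero r).mul_left (-(r : ℝ)))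
  convert! this using 1
  · funext n; ring
  · ring

lemma hasSum_poisson_sub_sq (r : ℝ≥0) :
    HasSum (fun n : ℕ => Real.exp (-r) * r ^ n / (n)! * ((n : ℝ) - r) ^ 2) r := by
  have := (hasSum_poisson_two r).add (((hasSum_poisson_one r).mul_left (-2 * (r : ℝ))).add
    ((hasSum_poisson_zero r).mul_left ((r : ℝ) ^ 2)))
  convert! this using 1
  · funext n; ring
  · ring

lemma hasSum_poisson_sub_pow_four (r : ℝ≥0) :
    HasSum (fun n : ℕ => Real.exp (-r) * r ^ n / (n)! * ((n : ℝ) - r) ^ 4)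
      (3 * (r : ℝ) ^ 2 + r) := by
  have := (hasSum_poisson_four r).add (((hasSum_poisson_three r).mul_left (-4 * (r : ℝ))).add
    (((hasSum_poisson_two r).mul_left (6 * (r : ℝ) ^ 2)).add
    (((hasSum_poisson_one r).mul_left (-4 * (r : ℝ) ^ 3)).add
    ((hasSum_poisson_zero r).mul_left ((r : ℝ) ^ 4)))))
  convert! this using 1
  · funext n; ring
  · ring

/-! ### The mean absolute difference of two independent Poisson variables -/

/-- The Dirichlet kernel. -/
noncomputable def dirichletKernel (k : ℕ) (t : ℝ) : ℝ :=
  1 + ∑ j ∈ Finset.range k, 2 * Real.cos ((j + 1 : ℕ) * t)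

/-- Multiplying `2 cos((k+1)t)` by `cos t` yields the two neighbouring cosines, so the product
telescopes. The right side telescopes once more when summed over `k`, which produces the Fejér
kernel. -/
lemma one_sub_cos_mul_dirichletKernel (k : ℕ) (t : ℝ) :
    (1 - Real.cos t) * dirichletKernel k t = Real.cos (k * t) - Real.cos ((k + 1 : ℕ) * t) := by
  induction k with
  | zero => simp [dirichletKernel]
  | succ k ih =>
    have h : dirichletKernel (k + 1) t = dirichletKernel k t + 2 * Real.cos ((k + 1 : ℕ) * t) := by
      simp [dirichletKernel, Finset.sum_range_succ, add_assoc]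
    have h1 : Real.cos (k * t) = Real.cos ((k + 1 : ℕ) * t - t) := by
      congr 1; push_cast; ring
    have h2 : Real.cos ((k + 1 + 1 : ℕ) * t) = Real.cos ((k + 1 : ℕ) * t + t) := by
      congr 1; push_cast; ring
    rw [h, mul_add, ih, h2, h1, Real.cos_sub, Real.cos_add]
    ring

lemma abs_dirichletKernel_le (k : ℕ) (t : ℝ) : |dirichletKernel k t| ≤ 2 * k + 1 := by
  unfold dirichletKernel
  refine (abs_add_le _ _).trans ?_
  have : |∑ j ∈ Finset.range k, 2 * Real.cos ((j + 1 : ℕ) * t)| ≤ ∑ j ∈ Finset.range k, (2 : ℝ) := by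
    refine (Finset.abs_sum_le_sum_abs _ _).trans (Finset.sum_le_sum fun j _ => ?_)
    rw [abs_mul, abs_two]
    nlinarith [Real.abs_cos_le_one ((j + 1 : ℕ) * t)]
  simp only [Finset.sum_const, Finset.card_range, nsmul_eq_mul] at this
  rw [abs_one]
  linarith

lemma continuous_dirichletKernel (k : ℕ) : Continuous (dirichletKernel k) := by
  unfold dirichletKernel
  fun_prop

lemma integral_dirichletKernel (k : ℕ) : ∫ t in (0 : ℝ)..Real.pi, dirichletKernel k t = Real.pi := by
  unfold dirichletKernel
  rw [intervalIntegral.integral_add (by simp) (Continuous.intervalIntegrable (by fun_prop) _ _),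
    intervalIntegral.integral_finsetSum
      (fun j _ => Continuous.intervalIntegrable (by fun_prop) _ _)]
  rw [Finset.sum_eq_zero]
  · simp
  · intro j _
    have hj : ((j + 1 : ℕ) : ℝ) ≠ 0 := by positivity
    rw [intervalIntegral.integral_const_mul, intervalIntegral.integral_comp_mul_left _ hj]
    simp only [mul_zero, integral_cos, Real.sin_zero, sub_zero, Real.sin_nat_mul_pi, smul_zero]

lemma one_sub_cos_pos {t : ℝ} (ht : t ∈ Ioo 0 Real.pi) : 0 < 1 - Real.cos t := by
  have := Real.cos_lt_cos_of_nonneg_of_le_pi le_rfl ht.2.le ht.1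
  rw [Real.cos_zero] at this
  linarith

lemma fejer_eq_sum (k : ℕ) {t : ℝ} (ht : t ∈ Ioo 0 Real.pi) :
    (1 - Real.cos (k * t)) / (1 - Real.cos t) = ∑ i ∈ Finset.range k, dirichletKernel i t := by
  have h := one_sub_cos_pos ht
  rw [div_eq_iff h.ne', Finset.sum_mul]
  simp_rw [mul_comm _ (1 - Real.cos t), one_sub_cos_mul_dirichletKernel]
  rw [Finset.sum_range_sub']
  simp

/-- The quotient is a sum of `k` Dirichlet kernels, each of integral `π`. This represents an
absolute value as a mixture of cosines, whose expectations are known. -/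
lemma integral_fejer (k : ℕ) :
    ∫ t in Ioo 0 Real.pi, (1 - Real.cos (k * t)) / (1 - Real.cos t) = Real.pi * k := by
  rw [setIntegral_congr_fun measurableSet_Ioo (fun t ht => fejer_eq_sum k ht),
    ← integral_Ioc_eq_integral_Ioo, ← intervalIntegral.integral_of_le Real.pi_pos.le,
    intervalIntegral.integral_finsetSum
      (fun j _ => (continuous_dirichletKernel j).intervalIntegrable _ _)]
  simp [integral_dirichletKernel, mul_comm]

lemma fejer_nonneg (z t : ℝ) : 0 ≤ (1 - Real.cos z) / (1 - Real.cos t) :=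
  div_nonneg (by linarith [Real.cos_le_one z]) (by linarith [Real.cos_le_one t])

/-- The bounds `2i + 1` on the Dirichlet kernels add up to `k²`. Second moments of Poisson variables
are finite, so this majorant justifies Fubini below. -/
lemma fejer_le (k : ℕ) {t : ℝ} (ht : t ∈ Ioo 0 Real.pi) :
    (1 - Real.cos (k * t)) / (1 - Real.cos t) ≤ (k : ℝ) ^ 2 := by
  rw [fejer_eq_sum k ht]
  refine (le_abs_self _).trans ((Finset.abs_sum_le_sum_abs _ _).trans
    ((Finset.sum_le_sum fun i _ => abs_dirichletKernel_le i t).trans ?_))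
  apply le_of_eq
  induction k with
  | zero => simp
  | succ k ih => rw [Finset.sum_range_succ, ih]; push_cast; ring

lemma cos_sub_mul_eq_natAbs (k l : ℕ) (t : ℝ) :
    Real.cos (((k : ℝ) - l) * t) = Real.cos (((k - l : ℤ).natAbs : ℝ) * t) := by
  have : (((k - l : ℤ).natAbs : ℝ)) = |(k : ℝ) - l| := by
    rw [Nat.cast_natAbs]; push_cast; rfl
  rw [this]
  rcases abs_cases ((k : ℝ) - l) with h | h
  · rw [h.1]
  · rw [h.1, ← Real.cos_neg]; congr 1; ring

lemma integral_fejer_sub (k l : ℕ) :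
    ∫ t in Ioo 0 Real.pi, (1 - Real.cos (((k : ℝ) - l) * t)) / (1 - Real.cos t)
      = Real.pi * |(k : ℝ) - l| := by
  simp_rw [cos_sub_mul_eq_natAbs]
  rw [integral_fejer, Nat.cast_natAbs]
  push_cast
  rfl

lemma fejer_sub_le (k l : ℕ) {t : ℝ} (ht : t ∈ Ioo 0 Real.pi) :
    (1 - Real.cos (((k : ℝ) - l) * t)) / (1 - Real.cos t) ≤ ((k : ℝ) - l) ^ 2 := by
  rw [cos_sub_mul_eq_natAbs]
  refine (fejer_le _ ht).trans (le_of_eq ?_)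
  rw [Nat.cast_natAbs]
  push_cast
  rw [sq_abs]

/-- The left side is the squared modulus of the characteristic function `exp(r (e^{it} - 1))`, whose
exponent has real part `r (cos t - 1)`. -/
lemma integral_poisson_cos_sq_add_sin_sq (r : ℝ≥0) (t : ℝ) :
    (∫ k : ℕ, Real.cos (k * t) ∂(poissonMeasure r)) ^ 2
      + (∫ k : ℕ, Real.sin (k * t) ∂(poissonMeasure r)) ^ 2
      = Real.exp (-(2 * r * (1 - Real.cos t))) := by
  have hint : Integrable (fun k : ℕ => Complex.exp ((k * t : ℝ) * Complex.I)) (poissonMeasure r) :=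
    Integrable.of_bound (C := 1) (by fun_prop) (by
      filter_upwards with k
      rw [Complex.norm_exp_ofReal_mul_I])
  have hφ : ∫ k : ℕ, Complex.exp ((k * t : ℝ) * Complex.I) ∂(poissonMeasure r)
      = Complex.exp (r * (Complex.exp (t * Complex.I) - 1)) := by
    rw [← charFun_map_cast_poissonMeasure, charFun_apply, integral_map .of_discrete (by fun_prop)]
    simp [mul_comm]
  have hre : ∫ k : ℕ, Real.cos (k * t) ∂(poissonMeasure r)
      = (∫ k : ℕ, Complex.exp ((k * t : ℝ) * Complex.I) ∂(poissonMeasure r)).re := by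
    have := integral_re hint
    simp only [Complex.exp_ofReal_mul_I_re, RCLike.re_eq_complex_re] at this
    exact this
  have him : ∫ k : ℕ, Real.sin (k * t) ∂(poissonMeasure r)
      = (∫ k : ℕ, Complex.exp ((k * t : ℝ) * Complex.I) ∂(poissonMeasure r)).im := by
    have := integral_im hint
    simp only [Complex.exp_ofReal_mul_I_im, RCLike.im_eq_complex_im] at this
    exact this
  rw [hre, him, hφ]
  set z := Complex.exp (r * (Complex.exp (t * Complex.I) - 1)) with hz
  have h1 : z.re ^ 2 + z.im ^ 2 = ‖z‖ ^ 2 := by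
    rw [← Complex.normSq_eq_norm_sq, Complex.normSq_apply]; ring
  rw [h1, hz, Complex.norm_exp, ← Real.exp_nat_mul]
  congr 1
  simp [Complex.exp_ofReal_mul_I_re]
  ring

lemma integral_prod_poisson_one_sub_cos (r : ℝ≥0) (t : ℝ) :
    ∫ p : ℕ × ℕ, (1 - Real.cos (((p.1 : ℝ) - p.2) * t))
        ∂((poissonMeasure r).prod (poissonMeasure r))
      = 1 - Real.exp (-(2 * r * (1 - Real.cos t))) := by
  rw [← integral_poisson_cos_sq_add_sin_sq]
  have e : ∀ p : ℕ × ℕ, Real.cos (((p.1 : ℝ) - p.2) * t)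
      = Real.cos (p.1 * t) * Real.cos (p.2 * t) + Real.sin (p.1 * t) * Real.sin (p.2 * t) := by
    intro p; rw [sub_mul, Real.cos_sub]
  have hc : Integrable (fun k : ℕ => Real.cos (k * t)) (poissonMeasure r) :=
    Integrable.of_bound (C := 1) (by fun_prop) (by
      filter_upwards with k
      exact Real.abs_cos_le_one _)
  have hs : Integrable (fun k : ℕ => Real.sin (k * t)) (poissonMeasure r) :=
    Integrable.of_bound (C := 1) (by fun_prop) (by
      filter_upwards with k
      exact Real.abs_sin_le_one _)
  simp_rw [e]
  rw [integral_sub (integrable_const _) (by exact (hc.mul_prod hc).add (hs.mul_prod hs)),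
    integral_add (hc.mul_prod hc) (hs.mul_prod hs),
    integral_prod_mul (fun k : ℕ => Real.cos (k * t)) (fun k : ℕ => Real.cos (k * t)),
    integral_prod_mul (fun k : ℕ => Real.sin (k * t)) (fun k : ℕ => Real.sin (k * t))]
  simp [sq]

lemma integrable_prod_poisson_sub_sq (r : ℝ≥0) :
    Integrable (fun p : ℕ × ℕ => ((p.1 : ℝ) - p.2) ^ 2)
      ((poissonMeasure r).prod (poissonMeasure r)) := by
  have h2 := integrable_poisson_of_hasSum (hasSum_poisson_sub_sq r)
  have := (h2.comp_fst (poissonMeasure r)).add (h2.comp_snd (poissonMeasure r))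
  refine (this.const_mul 2).mono' (by fun_prop) ?_
  filter_upwards with p
  simp only [Pi.add_apply]
  rw [Real.norm_of_nonneg (sq_nonneg _)]
  nlinarith [sq_nonneg (((p.1 : ℝ) - r) + (p.2 - r))]

/-- The mean absolute difference of two independent Poisson variables as a Fourier integral. -/
lemma integral_prod_poisson_abs_sub (r : ℝ≥0) :
    ∫ p : ℕ × ℕ, |(p.1 : ℝ) - p.2| ∂((poissonMeasure r).prod (poissonMeasure r))
      = Real.pi⁻¹ * ∫ t in Ioo 0 Real.pi,
          (1 - Real.exp (-(2 * r * (1 - Real.cos t)))) / (1 - Real.cos t) := by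
  have h1 : ∀ p : ℕ × ℕ, |(p.1 : ℝ) - p.2| = Real.pi⁻¹ *
      ∫ t in Ioo 0 Real.pi, (1 - Real.cos (((p.1 : ℝ) - p.2) * t)) / (1 - Real.cos t) := by
    intro p
    rw [integral_fejer_sub, ← mul_assoc, inv_mul_cancel₀ Real.pi_ne_zero, one_mul]
  simp_rw [h1]
  rw [integral_const_mul, integral_integral_swap]
  · congr 1
    refine setIntegral_congr_fun measurableSet_Ioo fun t _ => ?_
    rw [integral_div, integral_prod_poisson_one_sub_cos]
  · have : Integrable (fun q : (ℕ × ℕ) × ℝ => ((q.1.1 : ℝ) - q.1.2) ^ 2)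
        (((poissonMeasure r).prod (poissonMeasure r)).prod (volume.restrict (Ioo 0 Real.pi))) :=
      (integrable_prod_poisson_sub_sq r).comp_fst _
    refine this.mono' ?_ ?_
    · apply Measurable.aestronglyMeasurable
      simp only [Function.uncurry_def]
      fun_prop
    · have hae : ∀ᵐ q ∂(((poissonMeasure r).prod (poissonMeasure r)).prod
          (volume.restrict (Ioo 0 Real.pi))), q.2 ∈ Ioo 0 Real.pi :=
        Measure.quasiMeasurePreserving_snd.ae (ae_restrict_mem measurableSet_Ioo)
      filter_upwards [hae] with q hq
      simp only [Function.uncurry_def]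
      rw [Real.norm_of_nonneg (fejer_nonneg _ _)]
      exact fejer_sub_le _ _ hq

/-! ### Asymptotics of the mean absolute difference -/

lemma one_sub_exp_neg_div_nonneg {c w : ℝ} (hc : 0 ≤ c) (hw : 0 < w) :
    0 ≤ (1 - Real.exp (-(c * w))) / w := by
  have : Real.exp (-(c * w)) ≤ 1 := Real.exp_le_one_iff.2 (by nlinarith [mul_nonneg hc hw.le])
  exact div_nonneg (by linarith) hw.le

/-- Since `1 - e^{-cw} ≤ min(cw, 1)`, the quotient is at most `c` and at most `1/w`; the latter
controls it for large `s`. The majorant depends on `w` only through the lower bound `q s²`, so it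
serves the rescaled integrands uniformly as well as their limit. -/
lemma one_sub_exp_neg_div_le {c w q : ℝ} (hc : 0 ≤ c) (hq : 0 < q) (s : ℝ) (hw0 : 0 < w)
    (hw : q * s ^ 2 ≤ w) :
    (1 - Real.exp (-(c * w))) / w ≤ (c + q⁻¹) * (1 + s ^ 2)⁻¹ := by
  have h1 : 1 - Real.exp (-(c * w)) ≤ c * w := by linarith [Real.add_one_le_exp (-(c * w))]
  have h2 : 1 - Real.exp (-(c * w)) ≤ 1 := by linarith [Real.exp_pos (-(c * w))]
  have h3 : 0 ≤ 1 - Real.exp (-(c * w)) := by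
    have := one_sub_exp_neg_div_nonneg hc hw0
    rw [le_div_iff₀ hw0] at this
    linarith
  have hs : 0 < 1 + s ^ 2 := by positivity
  rw [← div_eq_mul_inv, div_le_div_iff₀ hw0 hs]
  have h4 : s ^ 2 ≤ q⁻¹ * w := by
    rw [inv_mul_eq_div, le_div_iff₀ hq]; linarith
  nlinarith [mul_le_mul_of_nonneg_right h2 (sq_nonneg s)]

lemma integrableOn_one_sub_exp_neg_sq_div {x : ℝ} (hx : 0 < x) :
    IntegrableOn (fun s : ℝ => (1 - Real.exp (-(2 * x * (s ^ 2 / 2)))) / (s ^ 2 / 2)) (Ioi 0) := by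
  refine (integrable_inv_one_add_sq.integrableOn.const_mul (2 * x + (1 / 2 : ℝ)⁻¹)).mono'
    (Measurable.aestronglyMeasurable (by fun_prop)) ?_
  filter_upwards [ae_restrict_mem measurableSet_Ioi] with s hs
  have hs0 : 0 < s := hs
  rw [Real.norm_of_nonneg (one_sub_exp_neg_div_nonneg (by positivity) (by positivity))]
  exact one_sub_exp_neg_div_le (by positivity) (by positivity) s (by positivity) (by linarith)

lemma integral_one_sub_exp_neg_sq_div {x : ℝ} (hx : 0 < x) :
    ∫ s in Ioi (0 : ℝ), (1 - Real.exp (-(2 * x * (s ^ 2 / 2)))) / (s ^ 2 / 2)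
      = 2 * Real.sqrt (Real.pi * x) := by
  -- Integration by parts: `G` is a primitive of the integrand minus the Gaussian `4x e^{-xs²}`. It
  -- vanishes at both ends (at `0` the quotient has value `0`, which is also its limit), so the
  -- integral equals the Gaussian one.
  set G : ℝ → ℝ := fun s => -2 * (1 - Real.exp (-x * s ^ 2)) / s with hG
  have hbd : ∀ s : ℝ, 0 ≤ s → |G s| ≤ 2 * x * s := by
    intro s hs
    rcases hs.eq_or_lt with rfl | hs
    · simp [hG]
    have h1 : 1 - Real.exp (-x * s ^ 2) ≤ x * s ^ 2 := by
      linarith [Real.add_one_le_exp (-x * s ^ 2)]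
    have h2 : Real.exp (-x * s ^ 2) ≤ 1 := Real.exp_le_one_iff.2 (by nlinarith [sq_nonneg s])
    simp only [hG]
    rw [abs_div, abs_mul, abs_of_pos hs, abs_of_nonneg (by linarith : (0 : ℝ) ≤ 1 - _),
      div_le_iff₀ hs, abs_neg, abs_two]
    nlinarith
  have hcont : ContinuousWithinAt G (Ici 0) 0 := by
    have h0 : G 0 = 0 := by simp [hG]
    rw [ContinuousWithinAt, h0]
    refine squeeze_zero_norm' (a := fun s => 2 * x * s) ?_ ?_
    · filter_upwards [self_mem_nhdsWithin] with s hs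
      exact hbd s hs
    · have : Tendsto (fun s : ℝ => 2 * x * s) (𝓝 0) (𝓝 (2 * x * 0)) :=
        (continuous_const.mul continuous_id).tendsto 0
      rw [mul_zero] at this
      exact this.mono_left nhdsWithin_le_nhds
  have hderiv : ∀ s ∈ Ioi (0 : ℝ), HasDerivAt G
      ((1 - Real.exp (-(2 * x * (s ^ 2 / 2)))) / (s ^ 2 / 2) - 4 * x * Real.exp (-x * s ^ 2)) s := by
    intro s hs
    have hs0 : s ≠ 0 := (ne_of_gt hs)
    have h1 : HasDerivAt (fun s : ℝ => -x * s ^ 2) (-x * (2 * s)) s := by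
      simpa using (hasDerivAt_pow 2 s).const_mul (-x)
    have h2 := ((h1.exp.const_sub 1).const_mul (-2)).div (hasDerivAt_id s) hs0
    refine h2.congr_deriv ?_
    have e : -(2 * x * (s ^ 2 / 2)) = -x * s ^ 2 := by ring
    rw [e]
    simp only [id]
    field_simp
    ring
  have hgauss : IntegrableOn (fun s : ℝ => 4 * x * Real.exp (-x * s ^ 2)) (Ioi 0) :=
    ((integrable_exp_neg_mul_sq hx).const_mul _).integrableOn
  have hlim : Tendsto G atTop (𝓝 0) := by
    refine squeeze_zero_norm' (a := fun s => 2 / s) ?_ (tendsto_const_nhds.div_atTop tendsto_id)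
    filter_upwards [eventually_gt_atTop 0] with s hs
    have h2 : Real.exp (-x * s ^ 2) ≤ 1 := Real.exp_le_one_iff.2 (by nlinarith [sq_nonneg s])
    simp only [hG]
    rw [norm_div, norm_mul, Real.norm_of_nonneg hs.le,
      Real.norm_of_nonneg (by linarith : (0 : ℝ) ≤ 1 - _)]
    norm_num
    gcongr
    linarith [Real.exp_pos (-(x * s ^ 2))]
  have key := integral_Ioi_of_hasDerivAt_of_tendsto hcont hderiv
    ((integrableOn_one_sub_exp_neg_sq_div hx).sub hgauss) hlim
  rw [integral_sub (integrableOn_one_sub_exp_neg_sq_div hx) hgauss, integral_const_mul,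
    integral_gaussian_Ioi] at key
  have h0 : G 0 = 0 := by simp [hG]
  rw [h0, sub_zero, sub_eq_zero] at key
  rw [key, Real.sqrt_div Real.pi_pos.le, Real.sqrt_mul Real.pi_pos.le]
  have : Real.sqrt x * Real.sqrt x = x := Real.mul_self_sqrt hx.le
  have hsx : Real.sqrt x ≠ 0 := (Real.sqrt_pos.2 hx).ne'
  field_simp
  nlinarith

/-- The half-angle formula writes the expression as `s²/2 · sinc²(s/(2√m))`, and `sinc` is
continuous with value `1` at `0`. -/
lemma tendsto_mul_one_sub_cos_div_sqrt (s : ℝ) :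
    Tendsto (fun m : ℕ => (m : ℝ) * (1 - Real.cos ((Real.sqrt m)⁻¹ * s))) atTop
      (𝓝 (s ^ 2 / 2)) := by
  have hb : Tendsto (fun m : ℕ => (Real.sqrt m)⁻¹ * s / 2) atTop (𝓝 (0 * s / 2)) :=
    ((tendsto_inv_atTop_zero.comp (Real.tendsto_sqrt_atTop.comp
      tendsto_natCast_atTop_atTop)).mul_const s).div_const 2
  have h1 : Tendsto (fun m : ℕ => s ^ 2 / 2 * Real.sinc ((Real.sqrt m)⁻¹ * s / 2) ^ 2) atTop
      (𝓝 (s ^ 2 / 2 * Real.sinc (0 * s / 2) ^ 2)) :=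
    (((Real.continuous_sinc.tendsto _).comp hb).pow 2).const_mul _
  have h2 : s ^ 2 / 2 * Real.sinc (0 * s / 2) ^ 2 = s ^ 2 / 2 := by simp
  rw [h2] at h1
  refine h1.congr' ?_
  filter_upwards [eventually_gt_atTop 0] with m hm
  have hm' : (0 : ℝ) < m := by exact_mod_cast hm
  have hsq : Real.sqrt m ^ 2 = m := Real.sq_sqrt hm'.le
  have hsp : 0 < Real.sqrt m := Real.sqrt_pos.2 hm'
  rcases eq_or_ne s 0 with rfl | hs
  · simp
  have hu : (Real.sqrt m)⁻¹ * s / 2 ≠ 0 := by positivity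
  have hc : Real.cos ((Real.sqrt m)⁻¹ * s) = 1 - 2 * Real.sin ((Real.sqrt m)⁻¹ * s / 2) ^ 2 := by
    have := Real.cos_two_mul ((Real.sqrt m)⁻¹ * s / 2)
    rw [mul_div_cancel₀ _ two_ne_zero] at this
    rw [this, Real.cos_sq']
    ring
  rw [hc, Real.sinc_of_ne_zero hu]
  nth_rw 3 [← hsq]
  field_simp
  ring

/-- The mass sits at `t` of order `m^(-1/2)`. After `t = s/√m` the integrand depends on `m` only
through `w = m (1 - cos(s/√m)) → s²/2`, and dominated convergence applies. -/
lemma tendsto_scaled_integral {x : ℝ} (hx : 0 < x) :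
    Tendsto (fun m : ℕ => (Real.sqrt m)⁻¹ * ∫ t in Ioo 0 Real.pi,
        (1 - Real.exp (-(2 * (m * x) * (1 - Real.cos t)))) / (1 - Real.cos t)) atTop
      (𝓝 (2 * Real.sqrt (Real.pi * x))) := by
  -- The indicator keeps the cut-off at `π` inside the integrand, so that all rescaled integrals run
  -- over the same half line.
  set g : ℕ → ℝ → ℝ := fun m => (Iio Real.pi).indicator
    (fun t => (1 - Real.exp (-(2 * (m * x) * (1 - Real.cos t)))) / (1 - Real.cos t)) with hg
  have hgm : ∀ m, Measurable (g m) := fun m => by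
    apply Measurable.indicator _ measurableSet_Iio
    fun_prop
  have hscale : ∀ᶠ m : ℕ in atTop, ∫ s in Ioi (0 : ℝ), (m : ℝ)⁻¹ * g m ((Real.sqrt m)⁻¹ * s)
      = (Real.sqrt m)⁻¹ * ∫ t in Ioo 0 Real.pi,
        (1 - Real.exp (-(2 * (m * x) * (1 - Real.cos t)))) / (1 - Real.cos t) := by
    filter_upwards [eventually_gt_atTop 0] with m hm
    have hm' : (0 : ℝ) < m := by exact_mod_cast hm
    have hsp : 0 < Real.sqrt m := Real.sqrt_pos.2 hm'
    have hsq : Real.sqrt m * Real.sqrt m = m := Real.mul_self_sqrt hm'.le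
    rw [integral_const_mul, integral_comp_mul_left_Ioi (g m) 0 (inv_pos.2 hsp), mul_zero, inv_inv,
      smul_eq_mul, ← mul_assoc]
    congr 1
    · nth_rw 1 [← hsq]
      field_simp
    · rw [hg, setIntegral_indicator measurableSet_Iio, Ioi_inter_Iio]
  refine Tendsto.congr' hscale ?_
  rw [← integral_one_sub_exp_neg_sq_div hx]
  -- The constant comes from `cos u ≤ 1 - 2u²/π²` for `|u| ≤ π`, which gives `w ≥ (2/π²) s²`.
  have hq : 0 < 2 / Real.pi ^ 2 := by positivity
  have key : ∀ᶠ m : ℕ in atTop, ∀ s ∈ Ioi (0 : ℝ), (Real.sqrt m)⁻¹ * s < Real.pi →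
      (m : ℝ)⁻¹ * g m ((Real.sqrt m)⁻¹ * s)
        = (1 - Real.exp (-(2 * x * (m * (1 - Real.cos ((Real.sqrt m)⁻¹ * s))))))
          / (m * (1 - Real.cos ((Real.sqrt m)⁻¹ * s))) := by
    filter_upwards [eventually_gt_atTop 0] with m hm s hs hlt
    simp only [hg]
    rw [indicator_of_mem (by exact hlt)]
    rw [div_mul_eq_div_div_swap, inv_mul_eq_div]
    ring_nf
  refine tendsto_integral_filter_of_dominated_convergence
    (fun s => (2 * x + (2 / Real.pi ^ 2)⁻¹) * (1 + s ^ 2)⁻¹) ?_ ?_ ?_ ?_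
  · filter_upwards with m
    exact (((hgm m).comp (measurable_const_mul _)).const_mul _).aestronglyMeasurable
  · filter_upwards [key, eventually_gt_atTop 0] with m hkey hm
    filter_upwards [ae_restrict_mem measurableSet_Ioi] with s hs
    have hm' : (0 : ℝ) < m := by exact_mod_cast hm
    have hsp : 0 < Real.sqrt m := Real.sqrt_pos.2 hm'
    have hsq : Real.sqrt m ^ 2 = m := Real.sq_sqrt hm'.le
    have hs0 : 0 < s := hs
    by_cases hlt : (Real.sqrt m)⁻¹ * s < Real.pi
    · rw [hkey s hs hlt]
      have hw0 : 0 < (m : ℝ) * (1 - Real.cos ((Real.sqrt m)⁻¹ * s)) :=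
        mul_pos hm' (one_sub_cos_pos ⟨by positivity, hlt⟩)
      rw [Real.norm_of_nonneg (one_sub_exp_neg_div_nonneg (by positivity) hw0)]
      refine one_sub_exp_neg_div_le (by positivity) hq s hw0 ?_
      have hc := Real.cos_le_one_sub_mul_cos_sq (x := (Real.sqrt m)⁻¹ * s) (by
        rw [abs_of_pos (by positivity)]; exact hlt.le)
      have : (m : ℝ) * (2 / Real.pi ^ 2 * ((Real.sqrt m)⁻¹ * s) ^ 2) = 2 / Real.pi ^ 2 * s ^ 2 := by
        nth_rw 1 [← hsq]
        field_simp
      rw [← this]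
      gcongr
      linarith
    · simp only [hg]
      rw [indicator_of_notMem (by exact hlt)]
      simp only [mul_zero, norm_zero]
      positivity
  · exact integrable_inv_one_add_sq.integrableOn.const_mul _
  · filter_upwards [ae_restrict_mem measurableSet_Ioi] with s hs
    have hs0 : 0 < s := hs
    have hw := tendsto_mul_one_sub_cos_div_sqrt s
    have hlim : Tendsto (fun m : ℕ =>
        (1 - Real.exp (-(2 * x * (m * (1 - Real.cos ((Real.sqrt m)⁻¹ * s))))))
          / (m * (1 - Real.cos ((Real.sqrt m)⁻¹ * s)))) atTop
        (𝓝 ((1 - Real.exp (-(2 * x * (s ^ 2 / 2)))) / (s ^ 2 / 2))) := by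
      refine Tendsto.div ?_ hw (by positivity)
      exact ((Real.continuous_exp.tendsto _).comp ((hw.const_mul (2 * x)).neg)).const_sub 1
    refine hlim.congr' ?_
    have hb : Tendsto (fun m : ℕ => (Real.sqrt m)⁻¹ * s) atTop (𝓝 (0 * s)) :=
      (tendsto_inv_atTop_zero.comp (Real.tendsto_sqrt_atTop.comp
        tendsto_natCast_atTop_atTop)).mul_const s
    rw [zero_mul] at hb
    filter_upwards [key, hb.eventually_lt_const Real.pi_pos] with m hkey hlt
    exact (hkey s hs hlt).symm

/-- `E|K - K'| / √m → 2 √(x / π)` for independent Poisson variables `K, K'` of mean `m x`. -/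
lemma tendsto_integral_prod_poisson_abs_sub {x : ℝ} (hx : 0 < x) :
    Tendsto (fun m : ℕ => (Real.sqrt m)⁻¹ * ∫ p : ℕ × ℕ, |(p.1 : ℝ) - p.2|
        ∂((poissonMeasure (m * x).toNNReal).prod (poissonMeasure (m * x).toNNReal))) atTop
      (𝓝 (2 * Real.sqrt (x / Real.pi))) := by
  have h := (tendsto_scaled_integral hx).const_mul Real.pi⁻¹
  have e : Real.pi⁻¹ * (2 * Real.sqrt (Real.pi * x)) = 2 * Real.sqrt (x / Real.pi) := by
    rw [Real.sqrt_mul Real.pi_pos.le, Real.sqrt_div hx.le]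
    have h1 : Real.sqrt Real.pi * Real.sqrt Real.pi = Real.pi := Real.mul_self_sqrt Real.pi_pos.le
    have h2 : Real.sqrt Real.pi ≠ 0 := (Real.sqrt_pos.2 Real.pi_pos).ne'
    have h3 := Real.pi_ne_zero
    field_simp
    nlinarith
  rw [e] at h
  refine h.congr fun m => ?_
  rw [integral_prod_poisson_abs_sub, Real.coe_toNNReal _ (by positivity)]
  ring

/-! ### Taylor expansions on the half line -/

section Taylor

variable {F f f' : ℝ → ℝ} {B L : ℝ}

lemma abs_sub_le_of_deriv_bound (hf : ∀ x ∈ Ici (0 : ℝ), HasDerivWithinAt F (f x) (Ici 0) x)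
    (hL : ∀ x ∈ Ici (0 : ℝ), |f x| ≤ L) {x y : ℝ} (hx : 0 ≤ x) (hy : 0 ≤ y) :
    |F y - F x| ≤ L * |y - x| :=
  Convex.norm_image_sub_le_of_norm_hasDerivWithin_le hf hL (convex_Ici 0) hx hy

lemma uIcc_subset_Ici {x y : ℝ} (hx : 0 ≤ x) (hy : 0 ≤ y) : uIcc x y ⊆ Ici 0 :=
  fun _ ht => (le_min hx hy).trans ht.1

/-- Mean value inequality for `t ↦ F t - f x * t` between `x` and `y`, where its derivative is at
most `B |y - x|`. The sharp constant `B/2` is not needed. -/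
lemma abs_taylor_one_le (hf : ∀ x ∈ Ici (0 : ℝ), HasDerivWithinAt F (f x) (Ici 0) x)
    (hf' : ∀ x ∈ Ici (0 : ℝ), HasDerivWithinAt f (f' x) (Ici 0) x)
    (hB : ∀ x ∈ Ici (0 : ℝ), |f' x| ≤ B) {x y : ℝ} (hx : 0 ≤ x) (hy : 0 ≤ y) :
    |F y - F x - f x * (y - x)| ≤ B * (y - x) ^ 2 := by
  have hB0 : 0 ≤ B := (abs_nonneg _).trans (hB 0 self_mem_Ici)
  have hs := uIcc_subset_Ici hx hy
  have h := Convex.norm_image_sub_le_of_norm_hasDerivWithin_le (s := uIcc x y)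
    (f := fun t => F t - f x * t) (f' := fun t => f t - f x * 1) (C := B * |y - x|)
    (fun t ht => ((hf t (hs ht)).mono hs).sub ((hasDerivWithinAt_id t _).const_mul (f x)))
    (fun t ht => by
      rw [mul_one]
      refine (abs_sub_le_of_deriv_bound hf' hB hx (hs ht)).trans ?_
      gcongr 1
      exact abs_sub_left_of_mem_uIcc ht)
    (convex_uIcc x y) left_mem_uIcc right_mem_uIcc
  rw [Real.norm_eq_abs, Real.norm_eq_abs, mul_assoc, ← sq, sq_abs] at h
  convert! h using 2
  ring

/-- Near `x`, differentiability of `f` at `x` gives the `ε`-term. Away from `x`, a quadratic bound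
is absorbed by the quartic term, which is harmless because the fourth central moment of `K/m` is
`O(m^(-2))`. -/
lemma exists_abs_taylor_two_le (hf : ∀ x ∈ Ici (0 : ℝ), HasDerivWithinAt F (f x) (Ici 0) x)
    (hf' : ∀ x ∈ Ici (0 : ℝ), HasDerivWithinAt f (f' x) (Ici 0) x)
    (hB : ∀ x ∈ Ici (0 : ℝ), |f' x| ≤ B) {x : ℝ} (hx : 0 ≤ x) {ε : ℝ} (hε : 0 < ε) :
    ∃ C : ℝ, ∀ y, 0 ≤ y →
      |F y - F x - f x * (y - x) - f' x / 2 * (y - x) ^ 2|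
        ≤ ε * (y - x) ^ 2 + C * (y - x) ^ 4 := by
  have hB0 : 0 ≤ B := (abs_nonneg _).trans (hB 0 self_mem_Ici)
  have hlo := (hasDerivWithinAt_iff_isLittleO.1 (hf' x hx)).def hε
  rw [eventually_iff, Metric.mem_nhdsWithin_iff] at hlo
  obtain ⟨δ, hδ, hsub⟩ := hlo
  -- For `|y - x| ≥ δ` the first-order remainder and the quadratic term are each at most `B (y -
  -- x)²`, and `(y - x)² ≤ (y - x)⁴/δ²`.
  refine ⟨2 * B / δ ^ 2, fun y hy => ?_⟩
  by_cases hlt : |y - x| < δ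
  · have hs := uIcc_subset_Ici hx hy
    have h := Convex.norm_image_sub_le_of_norm_hasDerivWithin_le (s := uIcc x y)
      (f := fun t => F t - f x * t - f' x / 2 * (t - x) ^ 2)
      (f' := fun t => f t - f x * 1 - f' x / 2 * (2 * (t - x))) (C := ε * |y - x|)
      (fun t ht => (((hf t (hs ht)).mono hs).sub ((hasDerivWithinAt_id t _).const_mul (f x))).sub
        (((((hasDerivAt_id t).sub_const x).pow 2).hasDerivWithinAt.congr_deriv
          (by simp)).const_mul _))
      (fun t ht => by
        have h1 : |t - x| ≤ |y - x| := abs_sub_left_of_mem_uIcc ht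
        have h2 := hsub ⟨by rw [Metric.mem_ball, Real.dist_eq]; linarith, hs ht⟩
        simp only [mem_ofPred_eq, smul_eq_mul] at h2
        refine le_trans (le_of_eq ?_) (h2.trans (by rw [Real.norm_eq_abs]; gcongr))
        congr 1
        ring)
      (convex_uIcc x y) left_mem_uIcc right_mem_uIcc
    rw [Real.norm_eq_abs, Real.norm_eq_abs, mul_assoc, ← sq, sq_abs] at h
    have h3 : 0 ≤ 2 * B / δ ^ 2 * (y - x) ^ 4 := by positivity
    refine le_trans (le_of_eq ?_) (h.trans (by linarith))
    congr 1
    ring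
  · push Not at hlt
    have h1 := abs_taylor_one_le hf hf' hB hx hy
    have h2 : |f' x / 2 * (y - x) ^ 2| ≤ B * (y - x) ^ 2 := by
      rw [abs_mul, abs_of_nonneg (sq_nonneg (y - x))]
      gcongr
      rw [abs_div, abs_two]
      linarith [hB x hx, abs_nonneg (f' x)]
    have h3 : 2 * B * (y - x) ^ 2 ≤ 2 * B / δ ^ 2 * (y - x) ^ 4 := by
      rw [div_mul_eq_mul_div, le_div_iff₀ (by positivity)]
      have : δ ^ 2 ≤ (y - x) ^ 2 := by
        rw [← sq_abs (y - x)]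
        gcongr
      have h4 : 0 ≤ 2 * B * (y - x) ^ 2 := by positivity
      nlinarith
    have h5 := abs_sub (F y - F x - f x * (y - x)) (f' x / 2 * (y - x) ^ 2)
    have h6 : 0 ≤ ε * (y - x) ^ 2 := by positivity
    linarith

end Taylor

/-! ### Poisson means of functions -/

/-- `E g(K / m)` for a Poisson variable `K` of mean `m x`. -/
noncomputable def poissonMean (m : ℕ) (x : ℝ) (g : ℝ → ℝ) : ℝ :=
  ∫ k : ℕ, g (k / m) ∂(poissonMeasure (m * x).toNNReal)

/-- `E g(min(K, K') / m)` for independent Poisson variables `K, K'` of mean `m x`. -/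
noncomputable def poissonMinMean (m : ℕ) (x : ℝ) (g : ℝ → ℝ) : ℝ :=
  ∫ p : ℕ × ℕ, g ((min p.1 p.2 : ℕ) / m)
    ∂((poissonMeasure (m * x).toNNReal).prod (poissonMeasure (m * x).toNNReal))

section Moments

variable {m : ℕ} {x : ℝ}

lemma integral_poisson_dev (hm : 0 < m) (hx : 0 ≤ x) :
    Integrable (fun k : ℕ => (k / m - x : ℝ)) (poissonMeasure (m * x).toNNReal) ∧
    ∫ k : ℕ, (k / m - x : ℝ) ∂(poissonMeasure (m * x).toNNReal) = 0 := by
  have hm' : (m : ℝ) ≠ 0 := by positivity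
  have h := (hasSum_poisson_sub (m * x).toNNReal).mul_right (1 / (m : ℝ))
  rw [Real.coe_toNNReal _ (by positivity)] at h
  have h' : HasSum (fun n : ℕ => Real.exp (-((m * x).toNNReal : ℝ)) * ((m * x).toNNReal : ℝ) ^ n
      / (n)! * (n / m - x : ℝ)) 0 := by
    convert! h using 1
    · funext n
      rw [Real.coe_toNNReal _ (by positivity)]
      field_simp
    · ring
  exact ⟨integrable_poisson_of_hasSum h', integral_poisson_of_hasSum h'⟩

lemma integral_poisson_dev_sq (hm : 0 < m) (hx : 0 ≤ x) :
    Integrable (fun k : ℕ => (k / m - x : ℝ) ^ 2) (poissonMeasure (m * x).toNNReal) ∧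
    ∫ k : ℕ, (k / m - x : ℝ) ^ 2 ∂(poissonMeasure (m * x).toNNReal) = x / m := by
  have hm' : (m : ℝ) ≠ 0 := by positivity
  have h := (hasSum_poisson_sub_sq (m * x).toNNReal).mul_right (1 / (m : ℝ) ^ 2)
  rw [Real.coe_toNNReal _ (by positivity)] at h
  have h' : HasSum (fun n : ℕ => Real.exp (-((m * x).toNNReal : ℝ)) * ((m * x).toNNReal : ℝ) ^ n
      / (n)! * (n / m - x : ℝ) ^ 2) (x / m) := by
    convert! h using 1
    · funext n
      rw [Real.coe_toNNReal _ (by positivity)]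
      field_simp
    · field_simp
  exact ⟨integrable_poisson_of_hasSum h', integral_poisson_of_hasSum h'⟩

lemma integral_poisson_dev_pow_four (hm : 0 < m) (hx : 0 ≤ x) :
    Integrable (fun k : ℕ => (k / m - x : ℝ) ^ 4) (poissonMeasure (m * x).toNNReal) ∧
    ∫ k : ℕ, (k / m - x : ℝ) ^ 4 ∂(poissonMeasure (m * x).toNNReal)
      = 3 * x ^ 2 / m ^ 2 + x / m ^ 3 := by
  have hm' : (m : ℝ) ≠ 0 := by positivity
  have h := (hasSum_poisson_sub_pow_four (m * x).toNNReal).mul_right (1 / (m : ℝ) ^ 4)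
  rw [Real.coe_toNNReal _ (by positivity)] at h
  have h' : HasSum (fun n : ℕ => Real.exp (-((m * x).toNNReal : ℝ)) * ((m * x).toNNReal : ℝ) ^ n
      / (n)! * (n / m - x : ℝ) ^ 4) (3 * x ^ 2 / m ^ 2 + x / m ^ 3) := by
    convert! h using 1
    · funext n
      rw [Real.coe_toNNReal _ (by positivity)]
      field_simp
    · field_simp
  exact ⟨integrable_poisson_of_hasSum h', integral_poisson_of_hasSum h'⟩

end Moments

section Asymptotics

variable {F f f' : ℝ → ℝ} {B L : ℝ}

lemma abs_integral_le_of_abs_le {α : Type*} [MeasurableSpace α] {ν : Measure α} {g b : α → ℝ}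
    (hb : Integrable b ν) (h : ∀ a, |g a| ≤ b a) : |∫ a, g a ∂ν| ≤ ∫ a, b a ∂ν :=
  norm_integral_le_of_norm_le (f := g) hb (Eventually.of_forall h)

lemma integrable_of_unit_bound {α : Type*} [MeasurableSpace α] [DiscreteMeasurableSpace α]
    {ν : Measure α} [IsFiniteMeasure ν] (hF01 : ∀ x, 0 ≤ F x ∧ F x ≤ 1) (u : α → ℝ) :
    Integrable (fun k => F (u k)) ν :=
  Integrable.of_bound (C := 1) (Measurable.of_discrete.aestronglyMeasurable) (by
    filter_upwards with k
    rw [Real.norm_of_nonneg (hF01 _).1]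
    exact (hF01 _).2)

lemma poissonMean_mem (hF01 : ∀ x, 0 ≤ F x ∧ F x ≤ 1) (m : ℕ) (x : ℝ) :
    0 ≤ poissonMean m x F ∧ poissonMean m x F ≤ 1 := by
  refine ⟨integral_nonneg fun k => (hF01 _).1, ?_⟩
  have := integral_mono (integrable_of_unit_bound (ν := poissonMeasure (m * x).toNNReal) hF01
    (fun k : ℕ => (k : ℝ) / m)) (integrable_const (1 : ℝ)) (fun k => (hF01 _).2)
  rwa [integral_const, probReal_univ, one_smul] at this

/-- `K/m` has mean `x` and variance `x/m`, so a linear term with any slope `b` integrates to zero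
and the quadratic one to `c x/m`. Taylor remainders can therefore be inserted under the integral. -/
lemma poissonMean_sub_eq (hF01 : ∀ x, 0 ≤ F x ∧ F x ≤ 1) {m : ℕ} (hm : 0 < m) {x : ℝ}
    (hx : 0 ≤ x) (b c : ℝ) :
    poissonMean m x F - F x - c * (x / m) =
      ∫ k : ℕ, (F (k / m) - F x - b * (k / m - x) - c * (k / m - x) ^ 2)
        ∂(poissonMeasure (m * x).toNNReal) := by
  have h0 := integrable_of_unit_bound (ν := poissonMeasure (m * x).toNNReal) hF01
    (fun k : ℕ => (k : ℝ) / m)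
  obtain ⟨i1, e1⟩ := integral_poisson_dev hm hx
  obtain ⟨i2, e2⟩ := integral_poisson_dev_sq hm hx
  rw [integral_sub (by exact (h0.sub (integrable_const _)).sub (i1.const_mul b)) (i2.const_mul c),
    integral_sub (by exact h0.sub (integrable_const _)) (i1.const_mul b),
    integral_sub h0 (integrable_const _), integral_const_mul, integral_const_mul, e1, e2]
  simp [poissonMean]

lemma abs_poissonMean_sub_le (hF01 : ∀ x, 0 ≤ F x ∧ F x ≤ 1)
    (hf : ∀ x ∈ Ici (0 : ℝ), HasDerivWithinAt F (f x) (Ici 0) x)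
    (hf' : ∀ x ∈ Ici (0 : ℝ), HasDerivWithinAt f (f' x) (Ici 0) x)
    (hB : ∀ x ∈ Ici (0 : ℝ), |f' x| ≤ B) {m : ℕ} (hm : 0 < m) {x : ℝ} (hx : 0 ≤ x) :
    |poissonMean m x F - F x| ≤ B * (x / m) := by
  have h := poissonMean_sub_eq hF01 hm hx (f x) 0
  obtain ⟨i2, e2⟩ := integral_poisson_dev_sq hm hx
  rw [zero_mul, sub_zero] at h
  rw [h, ← e2, ← integral_const_mul]
  refine abs_integral_le_of_abs_le (i2.const_mul B) fun k => ?_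
  rw [zero_mul, sub_zero]
  exact abs_taylor_one_le hf hf' hB hx (by positivity)

lemma tendsto_mul_poissonMean_sub (hF01 : ∀ x, 0 ≤ F x ∧ F x ≤ 1)
    (hf : ∀ x ∈ Ici (0 : ℝ), HasDerivWithinAt F (f x) (Ici 0) x)
    (hf' : ∀ x ∈ Ici (0 : ℝ), HasDerivWithinAt f (f' x) (Ici 0) x)
    (hB : ∀ x ∈ Ici (0 : ℝ), |f' x| ≤ B) {x : ℝ} (hx : 0 ≤ x) :
    Tendsto (fun m : ℕ => (m : ℝ) * (poissonMean m x F - F x)) atTop (𝓝 (bS f' x)) := by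
  -- The primed version has strict `m > N`, which supplies `0 < m`.
  rw [Metric.tendsto_atTop']
  intro ε hε
  -- The `ε`-term will be multiplied by `x`; dividing by `x + 1` leaves at most `ε/2`, also when `x
  -- = 0`.
  have hη : 0 < ε / (2 * (x + 1)) := by positivity
  obtain ⟨C, hC⟩ := exists_abs_taylor_two_le hf hf' hB hx hη
  have hlim : Tendsto (fun m : ℕ => C * (3 * x ^ 2 * (m : ℝ)⁻¹ + x * ((m : ℝ)⁻¹) ^ 2)) atTop
      (𝓝 (C * (3 * x ^ 2 * 0 + x * 0 ^ 2))) := by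
    have := tendsto_inv_atTop_nhds_zero_nat (𝕜 := ℝ)
    exact ((this.const_mul _).add ((this.pow 2).const_mul _)).const_mul _
  have hlim0 : C * (3 * x ^ 2 * 0 + x * 0 ^ 2) = 0 := by ring
  rw [hlim0] at hlim
  obtain ⟨N, hN⟩ := eventually_atTop.1 (hlim.eventually_lt_const (half_pos hε))
  refine ⟨N, fun m hmN => ?_⟩
  have hm : 0 < m := by omega
  have hm' : (0 : ℝ) < m := by exact_mod_cast hm
  have hNm := hN m hmN.le
  obtain ⟨i2, e2⟩ := integral_poisson_dev_sq hm hx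
  obtain ⟨i4, e4⟩ := integral_poisson_dev_pow_four hm hx
  have h := poissonMean_sub_eq hF01 hm hx (f x) (f' x / 2)
  have hle : |poissonMean m x F - F x - f' x / 2 * (x / m)|
      ≤ ε / (2 * (x + 1)) * (x / m) + C * (3 * x ^ 2 / m ^ 2 + x / m ^ 3) := by
    rw [h, ← e2, ← e4, ← integral_const_mul, ← integral_const_mul,
      ← integral_add (i2.const_mul _) (i4.const_mul _)]
    refine abs_integral_le_of_abs_le ((i2.const_mul _).add (i4.const_mul _)) fun k => ?_
    exact hC _ (by positivity)
  rw [Real.dist_eq]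
  have e : (m : ℝ) * (poissonMean m x F - F x) - bS f' x
      = m * (poissonMean m x F - F x - f' x / 2 * (x / m)) := by
    unfold bS
    field_simp
  rw [e, abs_mul, abs_of_pos hm']
  have h1 : (m : ℝ) * |poissonMean m x F - F x - f' x / 2 * (x / m)|
      ≤ m * (ε / (2 * (x + 1)) * (x / m) + C * (3 * x ^ 2 / m ^ 2 + x / m ^ 3)) := by gcongr
  have h2 : (m : ℝ) * (ε / (2 * (x + 1)) * (x / m) + C * (3 * x ^ 2 / m ^ 2 + x / m ^ 3))
      = ε / 2 * (x / (x + 1)) + C * (3 * x ^ 2 * (m : ℝ)⁻¹ + x * ((m : ℝ)⁻¹) ^ 2) := by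
    field_simp
  have h3 : x / (x + 1) ≤ 1 := by rw [div_le_one (by positivity)]; linarith
  have h4 : ε / 2 * (x / (x + 1)) ≤ ε / 2 * 1 := by gcongr
  linarith

/-- Of this decomposition only the absolute difference survives in the mean, since both deviations
are centred. -/
lemma min_cast_div_eq (m : ℕ) (x : ℝ) (p : ℕ × ℕ) :
    ((min p.1 p.2 : ℕ) : ℝ) / m - x
      = ((p.1 / m - x) + (p.2 / m - x)) / 2 - 1 / (2 * m) * |(p.1 : ℝ) - p.2| := by
  have h : min (p.1 : ℝ) p.2 = (p.1 + p.2 - |(p.1 : ℝ) - p.2|) / 2 := by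
    rcases le_total (p.1 : ℝ) p.2 with h | h
    · rw [min_eq_left h, abs_of_nonpos (by linarith)]; ring
    · rw [min_eq_right h, abs_of_nonneg (by linarith)]; ring
  rw [Nat.cast_min, h]
  ring

lemma abs_min_div_sub_le (m : ℕ) (x : ℝ) (p : ℕ × ℕ) :
    ((min p.1 p.2 : ℕ) / m - x : ℝ) ^ 2 ≤ (p.1 / m - x : ℝ) ^ 2 + (p.2 / m - x : ℝ) ^ 2 := by
  rcases le_total p.1 p.2 with h | h
  · rw [min_eq_left h]; nlinarith [sq_nonneg (p.2 / m - x : ℝ)]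
  · rw [min_eq_right h]; nlinarith [sq_nonneg (p.1 / m - x : ℝ)]

lemma integral_prod_poisson_dev_sq {m : ℕ} (hm : 0 < m) {x : ℝ} (hx : 0 ≤ x) :
    Integrable (fun p : ℕ × ℕ => (p.1 / m - x : ℝ) ^ 2 + (p.2 / m - x : ℝ) ^ 2)
      ((poissonMeasure (m * x).toNNReal).prod (poissonMeasure (m * x).toNNReal)) ∧
    ∫ p : ℕ × ℕ, ((p.1 / m - x : ℝ) ^ 2 + (p.2 / m - x : ℝ) ^ 2)
      ∂((poissonMeasure (m * x).toNNReal).prod (poissonMeasure (m * x).toNNReal))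
      = 2 * (x / m) := by
  obtain ⟨i2, e2⟩ := integral_poisson_dev_sq hm hx
  have j1 := i2.comp_fst (poissonMeasure (m * x).toNNReal)
  have j2 := i2.comp_snd (poissonMeasure (m * x).toNNReal)
  refine ⟨j1.add j2, ?_⟩
  rw [integral_add j1 j2, integral_fun_fst (fun k : ℕ => (k / m - x : ℝ) ^ 2),
    integral_fun_snd (fun k : ℕ => (k / m - x : ℝ) ^ 2), e2]
  simp
  ring

/-- Lipschitz continuity of `F` and `u ≤ 1 + u²/2` with `u = √m |min(K, K')/m - x|` reduce this to
second moments. The bound is free of `m` and linear in `x`, as domination in the integrated error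
requires. -/
lemma abs_sqrt_mul_poissonMinMean_sub_le (hF01 : ∀ x, 0 ≤ F x ∧ F x ≤ 1)
    (hf : ∀ x ∈ Ici (0 : ℝ), HasDerivWithinAt F (f x) (Ici 0) x)
    (hL : ∀ x ∈ Ici (0 : ℝ), |f x| ≤ L) {m : ℕ} (hm : 0 < m) {x : ℝ} (hx : 0 ≤ x) :
    |Real.sqrt m * (F x - poissonMinMean m x F)| ≤ L * (1 + x) := by
  have hL0 : 0 ≤ L := (abs_nonneg _).trans (hL 0 self_mem_Ici)
  have hm' : (0 : ℝ) < m := by exact_mod_cast hm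
  have h0 := integrable_of_unit_bound
    (ν := (poissonMeasure (m * x).toNNReal).prod (poissonMeasure (m * x).toNNReal)) hF01
    (fun p : ℕ × ℕ => ((min p.1 p.2 : ℕ) : ℝ) / m)
  obtain ⟨i2, e2⟩ := integral_prod_poisson_dev_sq hm hx
  have e : Real.sqrt m * (F x - poissonMinMean m x F)
      = ∫ p : ℕ × ℕ, Real.sqrt m * (F x - F ((min p.1 p.2 : ℕ) / m))
        ∂((poissonMeasure (m * x).toNNReal).prod (poissonMeasure (m * x).toNNReal)) := by
    rw [integral_const_mul, integral_sub (integrable_const _) h0]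
    simp [poissonMinMean]
  have e' : L * (1 + x) = ∫ p : ℕ × ℕ, L * (1 + (m / 2 : ℝ) *
        ((p.1 / m - x : ℝ) ^ 2 + (p.2 / m - x : ℝ) ^ 2))
        ∂((poissonMeasure (m * x).toNNReal).prod (poissonMeasure (m * x).toNNReal)) := by
    rw [integral_const_mul, integral_add (integrable_const _) (i2.const_mul _),
      integral_const_mul, e2, integral_const, probReal_univ, one_smul]
    field_simp
  rw [e, e']
  refine abs_integral_le_of_abs_le
    (((integrable_const _).add (i2.const_mul _)).const_mul _) fun p => ?_
  rw [abs_mul, abs_of_nonneg (Real.sqrt_nonneg _)]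
  have h1 := abs_sub_le_of_deriv_bound hf hL hx
    (y := ((min p.1 p.2 : ℕ) : ℝ) / m) (by positivity)
  rw [abs_sub_comm] at h1
  have h2 := abs_min_div_sub_le m x p
  have hs : Real.sqrt m ^ 2 = m := Real.sq_sqrt hm'.le
  set d := |((min p.1 p.2 : ℕ) : ℝ) / m - x| with hd
  have h3 : Real.sqrt m * d ≤ 1 + (m / 2 : ℝ) *
      ((p.1 / m - x : ℝ) ^ 2 + (p.2 / m - x : ℝ) ^ 2) := by
    rw [← sq_abs, ← hd] at h2
    have h4 : (m : ℝ) / 2 * d ^ 2 ≤ m / 2 * ((p.1 / m - x : ℝ) ^ 2 + (p.2 / m - x : ℝ) ^ 2) := by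
      gcongr
    have h5 : (m : ℝ) / 2 * d ^ 2 = (Real.sqrt m * d) ^ 2 / 2 := by rw [mul_pow, hs]; ring
    nlinarith [sq_nonneg (Real.sqrt m * d - 1)]
  calc Real.sqrt m * |F x - F (((min p.1 p.2 : ℕ) : ℝ) / m)|
      ≤ Real.sqrt m * (L * d) := by gcongr
    _ = L * (Real.sqrt m * d) := by ring
    _ ≤ _ := by gcongr

/-- The linear Taylor term contributes exactly `f(x)/2 · m^(-1/2) E|K - K'|`, which tends to `V(x)`;
the quadratic remainder is `√m · O(1/m)`. -/
lemma tendsto_sqrt_mul_poissonMinMean_sub (hF01 : ∀ x, 0 ≤ F x ∧ F x ≤ 1)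
    (hf : ∀ x ∈ Ici (0 : ℝ), HasDerivWithinAt F (f x) (Ici 0) x)
    (hf' : ∀ x ∈ Ici (0 : ℝ), HasDerivWithinAt f (f' x) (Ici 0) x)
    (hB : ∀ x ∈ Ici (0 : ℝ), |f' x| ≤ B) {x : ℝ} (hx : 0 < x) :
    Tendsto (fun m : ℕ => Real.sqrt m * (F x - poissonMinMean m x F)) atTop (𝓝 (VS f x)) := by
  have h1 := (tendsto_integral_prod_poisson_abs_sub hx).const_mul (f x / 2)
  have e1 : f x / 2 * (2 * Real.sqrt (x / Real.pi)) = VS f x := by unfold VS; ring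
  rw [e1] at h1
  have h2 : Tendsto (fun m : ℕ => Real.sqrt m * (F x - poissonMinMean m x F)
      - f x / 2 * ((Real.sqrt m)⁻¹ * ∫ p : ℕ × ℕ, |(p.1 : ℝ) - p.2|
        ∂((poissonMeasure (m * x).toNNReal).prod (poissonMeasure (m * x).toNNReal)))) atTop
      (𝓝 0) := by
    have hb : Tendsto (fun m : ℕ => 2 * B * x * (Real.sqrt m)⁻¹) atTop (𝓝 (2 * B * x * 0)) :=
      (tendsto_inv_atTop_zero.comp (Real.tendsto_sqrt_atTop.comp
        tendsto_natCast_atTop_atTop)).const_mul _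
    rw [mul_zero] at hb
    refine squeeze_zero_norm' ?_ hb
    filter_upwards [eventually_gt_atTop 0] with m hm
    have hm' : (0 : ℝ) < m := by exact_mod_cast hm
    set ν := poissonMeasure (m * x).toNNReal
    have h0 := integrable_of_unit_bound (ν := ν.prod ν) hF01
      (fun p : ℕ × ℕ => ((min p.1 p.2 : ℕ) : ℝ) / m)
    obtain ⟨i2, e2⟩ := integral_prod_poisson_dev_sq hm hx.le
    obtain ⟨i1, d1⟩ := integral_poisson_dev hm hx.le
    have j1 := i1.comp_fst ν
    have j2 := i1.comp_snd ν
    have ja : Integrable (fun p : ℕ × ℕ => |(p.1 : ℝ) - p.2|) (ν.prod ν) := by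
      refine ((j1.sub j2).const_mul (m : ℝ)).abs.congr ?_
      filter_upwards with p
      simp only [Pi.sub_apply]
      congr 1
      field_simp
      ring
    have jm : Integrable (fun p : ℕ × ℕ => ((min p.1 p.2 : ℕ) : ℝ) / m - x) (ν.prod ν) := by
      simp_rw [min_cast_div_eq]
      exact ((j1.add j2).div_const 2).sub (ja.const_mul _)
    have em : ∫ p : ℕ × ℕ, (((min p.1 p.2 : ℕ) : ℝ) / m - x) ∂(ν.prod ν)
        = -(1 / (2 * m) * ∫ p : ℕ × ℕ, |(p.1 : ℝ) - p.2| ∂(ν.prod ν)) := by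
      simp_rw [min_cast_div_eq]
      rw [integral_sub (by exact (j1.add j2).div_const 2) (ja.const_mul _), integral_div,
        integral_add j1 j2, integral_fun_fst (fun k : ℕ => (k / m - x : ℝ)),
        integral_fun_snd (fun k : ℕ => (k / m - x : ℝ)), d1, integral_const_mul]
      simp
    have eR : Real.sqrt m * (F x - poissonMinMean m x F)
        - f x / 2 * ((Real.sqrt m)⁻¹ * ∫ p : ℕ × ℕ, |(p.1 : ℝ) - p.2| ∂(ν.prod ν))
        = -(Real.sqrt m * ∫ p : ℕ × ℕ, (F ((min p.1 p.2 : ℕ) / m) - F x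
          - f x * ((min p.1 p.2 : ℕ) / m - x)) ∂(ν.prod ν)) := by
      rw [integral_sub (by exact h0.sub (integrable_const _)) (jm.const_mul _),
        integral_sub h0 (integrable_const _), integral_const_mul, em]
      have hs : Real.sqrt m * Real.sqrt m = m := Real.mul_self_sqrt hm'.le
      have hs0 : Real.sqrt m ≠ 0 := (Real.sqrt_pos.2 hm').ne'
      have hi : Real.sqrt m * (1 / (2 * m)) = (Real.sqrt m)⁻¹ / 2 := by
        nth_rw 2 [← hs]
        field_simp
      have hM : poissonMinMean m x F = ∫ p : ℕ × ℕ, F ((min p.1 p.2 : ℕ) / m) ∂(ν.prod ν) := rfl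
      rw [integral_const, probReal_univ, one_smul, ← hM]
      linear_combination (f x * ∫ p : ℕ × ℕ, |(p.1 : ℝ) - p.2| ∂(ν.prod ν)) * hi
    rw [eR, norm_neg, norm_mul, Real.norm_of_nonneg (Real.sqrt_nonneg _)]
    have hle : ‖∫ p : ℕ × ℕ, (F ((min p.1 p.2 : ℕ) / m) - F x
          - f x * ((min p.1 p.2 : ℕ) / m - x)) ∂(ν.prod ν)‖ ≤ B * (2 * (x / m)) := by
      rw [← e2, ← integral_const_mul]
      refine abs_integral_le_of_abs_le (i2.const_mul _) fun p => ?_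
      have hB0 : 0 ≤ B := (abs_nonneg _).trans (hB 0 self_mem_Ici)
      exact (abs_taylor_one_le hf hf' hB hx.le (by positivity)).trans
        (mul_le_mul_of_nonneg_left (abs_min_div_sub_le m x p) hB0)
    calc Real.sqrt m * ‖_‖ ≤ Real.sqrt m * (B * (2 * (x / m))) := by gcongr
      _ = 2 * B * x * (Real.sqrt m)⁻¹ := by
        have hs : Real.sqrt m * Real.sqrt m = m := Real.mul_self_sqrt hm'.le
        have hs0 : Real.sqrt m ≠ 0 := (Real.sqrt_pos.2 hm').ne'
        nth_rw 2 [← hs]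
        field_simp
  have := h2.add h1
  simpa using this

/-- The variance factor `E F(min(K, K') / m) - (E F(K / m))²` of the Szasz estimator. -/
noncomputable def szaszVar (F : ℝ → ℝ) (m : ℕ) (x : ℝ) : ℝ :=
  poissonMinMean m x F - poissonMean m x F ^ 2

/-- Factoring the difference of squares shows that the second summand carries a bias of order `1/m`
and so disappears in the limit despite the factor `√m`. -/
lemma sqrt_mul_sigmaSq_sub_szaszVar (m : ℕ) (x : ℝ) :
    Real.sqrt m * (sigmaSq F x - szaszVar F m x)
      = Real.sqrt m * (F x - poissonMinMean m x F)
        + Real.sqrt m * (poissonMean m x F - F x) * (poissonMean m x F + F x) := by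
  unfold sigmaSq szaszVar
  ring

lemma abs_sqrt_mul_sigmaSq_sub_szaszVar_le (hF01 : ∀ x, 0 ≤ F x ∧ F x ≤ 1)
    (hf : ∀ x ∈ Ici (0 : ℝ), HasDerivWithinAt F (f x) (Ici 0) x)
    (hf' : ∀ x ∈ Ici (0 : ℝ), HasDerivWithinAt f (f' x) (Ici 0) x)
    (hL : ∀ x ∈ Ici (0 : ℝ), |f x| ≤ L)
    (hB : ∀ x ∈ Ici (0 : ℝ), |f' x| ≤ B) {m : ℕ} (hm : 0 < m) {x : ℝ} (hx : 0 ≤ x) :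
    |Real.sqrt m * (sigmaSq F x - szaszVar F m x)| ≤ L * (1 + x) + 2 * (B * x) := by
  have hm' : (1 : ℝ) ≤ m := by exact_mod_cast hm
  have hm0 : (0 : ℝ) < m := by linarith
  have hB0 : 0 ≤ B := (abs_nonneg _).trans (hB 0 self_mem_Ici)
  rw [sqrt_mul_sigmaSq_sub_szaszVar]
  refine (abs_add_le _ _).trans (add_le_add (abs_sqrt_mul_poissonMinMean_sub_le hF01 hf hL hm hx) ?_)
  have h1 := abs_poissonMean_sub_le hF01 hf hf' hB hm hx
  have h2 := poissonMean_mem hF01 m x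
  have h3 : |poissonMean m x F + F x| ≤ 2 := by
    rw [abs_of_nonneg (add_nonneg h2.1 (hF01 x).1)]; linarith [h2.2, (hF01 x).2]
  have hs : Real.sqrt m ≤ m := by
    rw [Real.sqrt_le_left hm0.le]; nlinarith
  rw [abs_mul, abs_mul, abs_of_nonneg (Real.sqrt_nonneg _)]
  calc Real.sqrt m * |poissonMean m x F - F x| * |poissonMean m x F + F x|
      ≤ m * (B * (x / m)) * 2 := by gcongr
    _ = 2 * (B * x) := by field_simp

lemma tendsto_sqrt_mul_sigmaSq_sub_szaszVar (hF01 : ∀ x, 0 ≤ F x ∧ F x ≤ 1)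
    (hf : ∀ x ∈ Ici (0 : ℝ), HasDerivWithinAt F (f x) (Ici 0) x)
    (hf' : ∀ x ∈ Ici (0 : ℝ), HasDerivWithinAt f (f' x) (Ici 0) x)
    (hB : ∀ x ∈ Ici (0 : ℝ), |f' x| ≤ B) {x : ℝ} (hx : 0 < x) :
    Tendsto (fun m : ℕ => Real.sqrt m * (sigmaSq F x - szaszVar F m x)) atTop
      (𝓝 (VS f x)) := by
  have h1 := tendsto_sqrt_mul_poissonMinMean_sub hF01 hf hf' hB hx
  have h2 := tendsto_mul_poissonMean_sub hF01 hf hf' hB hx.le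
  have hi : Tendsto (fun m : ℕ => (Real.sqrt m)⁻¹) atTop (𝓝 0) :=
    tendsto_inv_atTop_zero.comp (Real.tendsto_sqrt_atTop.comp tendsto_natCast_atTop_atTop)
  have h3 : Tendsto (fun m : ℕ => Real.sqrt m * (poissonMean m x F - F x)) atTop (𝓝 0) := by
    have := hi.mul h2
    rw [zero_mul] at this
    refine this.congr' ?_
    filter_upwards [eventually_gt_atTop 0] with m hm
    have hm' : (0 : ℝ) < m := by exact_mod_cast hm
    have hs : Real.sqrt m * Real.sqrt m = m := Real.mul_self_sqrt hm'.le
    have hs0 : Real.sqrt m ≠ 0 := (Real.sqrt_pos.2 hm').ne'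
    nth_rw 2 [← hs]
    field_simp
  have h4 : Tendsto (fun m : ℕ => Real.sqrt m * (poissonMean m x F - F x)
      * (poissonMean m x F + F x)) atTop (𝓝 0) := by
    refine squeeze_zero_norm (a := fun m : ℕ => ‖Real.sqrt m * (poissonMean m x F - F x)‖ * 2)
      (fun m => ?_) (by simpa using h3.norm.mul_const 2)
    have h5 := poissonMean_mem hF01 m x
    rw [norm_mul]
    gcongr
    rw [Real.norm_of_nonneg (add_nonneg h5.1 (hF01 x).1)]
    linarith [h5.2, (hF01 x).2]
  have := h1.add h4
  rw [add_zero] at this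
  exact this.congr fun m => (sqrt_mul_sigmaSq_sub_szaszVar m x).symm

end Asymptotics

/-! ### Sample means of a kernel -/

section SampleMean

variable {Ω : Type*}

/-- The sample mean `n⁻¹ ∑_{i < n} h(x, X_i)`. -/
noncomputable def sampleMean (h : ℝ → ℝ → ℝ) (X : ℕ → Ω → ℝ) (n : ℕ) (ω : Ω) (x : ℝ) : ℝ :=
  (1 / (n : ℝ)) * ∑ i ∈ Finset.range n, h x (X i ω)

/-- The kernel `1{t ≤ x}` of the empirical distribution function. -/
noncomputable def edfKernel (x t : ℝ) : ℝ := (Iic x).indicator (fun _ => (1 : ℝ)) t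

/-- The kernel `∑_k 1{t ≤ k / m} V_{k,m}(x)` of the Szasz estimator. -/
noncomputable def szaszKernel (m : ℕ) (x t : ℝ) : ℝ :=
  ∑' k : ℕ, edfKernel (k / m) t * poissonWeight k m x

lemma edfKernel_mem (x t : ℝ) : 0 ≤ edfKernel x t ∧ edfKernel x t ≤ 1 := by
  unfold edfKernel
  by_cases h : t ∈ Iic x <;> simp [h]

lemma edfKernel_mul (x y t : ℝ) : edfKernel x t * edfKernel y t = edfKernel (min x y) t := by
  by_cases h1 : t ≤ x <;> by_cases h2 : t ≤ y <;> simp [edfKernel, h1, h2]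

lemma measurable_edfKernel : Measurable (fun p : ℝ × ℝ => edfKernel p.2 p.1) := by
  have : (fun p : ℝ × ℝ => edfKernel p.2 p.1)
      = {p : ℝ × ℝ | p.1 ≤ p.2}.indicator (fun _ => (1 : ℝ)) := by
    funext p
    simp [edfKernel, indicator]
  rw [this]
  exact measurable_const.indicator (measurableSet_le measurable_fst measurable_snd)

lemma measurable_edfKernel_right (x : ℝ) : Measurable (edfKernel x) :=
  measurable_edfKernel.comp (measurable_id.prodMk measurable_const)

lemma summable_poissonWeight (m : ℕ) (x : ℝ) : Summable (fun k => poissonWeight k m x) := by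
  unfold poissonWeight
  simp_rw [mul_div_assoc]
  exact (Real.summable_pow_div_factorial _).mul_left _

lemma summable_edfKernel_mul_poissonWeight (m : ℕ) (x t : ℝ) :
    Summable (fun k : ℕ => edfKernel (k / m) t * poissonWeight k m x) := by
  refine Summable.of_norm_bounded (summable_poissonWeight m x).norm fun k => ?_
  rw [norm_mul, Real.norm_of_nonneg (edfKernel_mem _ _).1]
  exact mul_le_of_le_one_left (norm_nonneg _) (edfKernel_mem _ _).2

/-- Joint measurability, needed for Fubini, comes from the kernel being the pointwise limit of its
partial sums. -/
lemma measurable_szaszKernel (m : ℕ) : Measurable (fun p : ℝ × ℝ => szaszKernel m p.2 p.1) := by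
  refine measurable_of_tendsto_metrizable (f := fun (N : ℕ) (p : ℝ × ℝ) =>
    ∑ k ∈ Finset.range N, edfKernel (k / m) p.1 * poissonWeight k m p.2) (fun N => ?_) ?_
  · refine Finset.measurable_sum _ fun k _ => ?_
    refine ((measurable_edfKernel_right _).comp measurable_fst).mul ?_
    unfold poissonWeight
    fun_prop
  · rw [tendsto_pi_nhds]
    intro p
    exact (summable_edfKernel_mul_poissonWeight m p.2 p.1).hasSum.tendsto_sum_nat

lemma szasz_eq_sampleMean (X : ℕ → Ω → ℝ) (m n : ℕ) :
    szasz X m n = sampleMean (szaszKernel m) X n := by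
  funext ω x
  unfold szasz sampleMean szaszKernel edf
  rw [← Summable.tsum_finsetSum
    (fun i _ => summable_edfKernel_mul_poissonWeight m x (X i ω)), ← tsum_mul_left]
  congr 1
  funext k
  rw [mul_assoc, Finset.sum_mul]
  rfl

lemma edf_eq_sampleMean (X : ℕ → Ω → ℝ) (n : ℕ) : edf X n = sampleMean edfKernel X n := rfl

lemma sampleMean_mem {h : ℝ → ℝ → ℝ} {x : ℝ} (hh : ∀ t, 0 ≤ h x t ∧ h x t ≤ 1)
    (X : ℕ → Ω → ℝ) {n : ℕ} (hn : 0 < n) (ω : Ω) :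
    0 ≤ sampleMean h X n ω x ∧ sampleMean h X n ω x ≤ 1 := by
  have hn' : (0 : ℝ) < n := by exact_mod_cast hn
  unfold sampleMean
  refine ⟨mul_nonneg (by positivity) (Finset.sum_nonneg fun i _ => (hh _).1), ?_⟩
  have : ∑ i ∈ Finset.range n, h x (X i ω) ≤ ∑ i ∈ Finset.range n, (1 : ℝ) :=
    Finset.sum_le_sum fun i _ => (hh _).2
  rw [Finset.sum_const, Finset.card_range, nsmul_eq_mul, mul_one] at this
  rw [one_div_mul_eq_div, div_le_one hn']
  exact this

/-- The weights are the masses of the Poisson law of mean `m x`, so the kernel is the probability of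
`t ≤ K/m`. -/
lemma szaszKernel_eq_integral (m : ℕ) {x : ℝ} (hx : 0 ≤ x) (t : ℝ) :
    szaszKernel m x t
      = ∫ k : ℕ, edfKernel (k / m) t ∂(poissonMeasure (m * x).toNNReal) := by
  rw [integral_poissonMeasure, Real.coe_toNNReal _ (by positivity)]
  unfold szaszKernel poissonWeight
  simp_rw [smul_eq_mul, mul_comm]

lemma szaszKernel_mem (m : ℕ) {x : ℝ} (hx : 0 ≤ x) (t : ℝ) :
    0 ≤ szaszKernel m x t ∧ szaszKernel m x t ≤ 1 := by
  rw [szaszKernel_eq_integral m hx]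
  exact poissonMean_mem (F := fun y => edfKernel y t) (fun y => edfKernel_mem y t) m x

variable [MeasurableSpace Ω] {P : Measure Ω} {X : ℕ → Ω → ℝ} {F : ℝ → ℝ}

lemma integral_edfKernel (hX : ∀ i, Measurable (X i))
    (hF : ∀ i x, P.real {ω | X i ω ≤ x} = F x) (x : ℝ) :
    ∫ ω, edfKernel x (X 0 ω) ∂P = F x := by
  rw [← hF 0 x]
  have : (fun ω => edfKernel x (X 0 ω)) = {ω | X 0 ω ≤ x}.indicator (fun _ => (1 : ℝ)) := by
    funext ω; simp [edfKernel, indicator]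
  rw [this, integral_indicator_const _ (measurableSet_le (hX 0) measurable_const)]
  simp

lemma measurable_sampleMean {h : ℝ → ℝ → ℝ} (hh : Measurable (fun p : ℝ × ℝ => h p.2 p.1))
    (hX : ∀ i, Measurable (X i)) (n : ℕ) :
    Measurable (fun p : Ω × ℝ => sampleMean h X n p.1 p.2) := by
  unfold sampleMean
  refine measurable_const.mul (Finset.measurable_sum _ fun i _ => ?_)
  exact hh.comp (((hX i).comp measurable_fst).prodMk measurable_snd)

variable [IsProbabilityMeasure P]

lemma identDistrib_of_cdf (hX : ∀ i, Measurable (X i))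
    (hF : ∀ i x, P.real {ω | X i ω ≤ x} = F x) (i : ℕ) : IdentDistrib (X i) (X 0) P P := by
  refine ⟨(hX i).aemeasurable, (hX 0).aemeasurable, ?_⟩
  have := Measure.isProbabilityMeasure_map (μ := P) (hX i).aemeasurable
  refine Measure.ext_of_Iic _ _ fun x => ?_
  rw [Measure.map_apply (hX i) measurableSet_Iic, Measure.map_apply (hX 0) measurableSet_Iic,
    ← ENNReal.toReal_eq_toReal_iff' (measure_ne_top _ _) (measure_ne_top _ _)]
  exact (hF i x).trans (hF 0 x).symm

lemma memLp_unit_bound {g : Ω → ℝ} (hg : Measurable g) (h01 : ∀ ω, 0 ≤ g ω ∧ g ω ≤ 1) :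
    MemLp g 2 P :=
  MemLp.of_bound hg.aestronglyMeasurable 1 (Eventually.of_forall fun ω => by
    rw [Real.norm_of_nonneg (h01 ω).1]; exact (h01 ω).2)

/-- Bias-variance decomposition for the sample mean of a kernel with values in `[0, 1]`. -/
lemma mse_sampleMean (hX : ∀ i, Measurable (X i)) (hindep : iIndepFun X P)
    (hF : ∀ i x, P.real {ω | X i ω ≤ x} = F x) {h : ℝ → ℝ → ℝ} {x : ℝ} (hh : Measurable (h x))
    (h01 : ∀ t, 0 ≤ h x t ∧ h x t ≤ 1) {n : ℕ} (hn : 0 < n) :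
    mse P F (sampleMean h X n) x
      = (∫ ω, h x (X 0 ω) ^ 2 ∂P - (∫ ω, h x (X 0 ω) ∂P) ^ 2) / n
        + (∫ ω, h x (X 0 ω) ∂P - F x) ^ 2 := by
  have hn' : (0 : ℝ) < n := by exact_mod_cast hn
  set Z : Ω → ℝ := fun ω => sampleMean h X n ω x with hZ
  have hYm : ∀ i, MemLp (fun ω => h x (X i ω)) 2 P := fun i =>
    memLp_unit_bound (hh.comp (hX i)) fun ω => h01 _
  have hid : ∀ i, IdentDistrib (fun ω => h x (X i ω)) (fun ω => h x (X 0 ω)) P P := fun i =>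
    (identDistrib_of_cdf hX hF i).comp hh
  have hsum : (fun ω => ∑ i ∈ Finset.range n, h x (X i ω))
      = ∑ i ∈ Finset.range n, fun ω => h x (X i ω) := by
    funext ω; simp
  have hZm : MemLp Z 2 P := by
    have : MemLp (fun ω => ∑ i ∈ Finset.range n, h x (X i ω)) 2 P :=
      memLp_finsetSum _ fun i _ => hYm i
    exact this.const_mul _
  have hmean : ∫ ω, Z ω ∂P = ∫ ω, h x (X 0 ω) ∂P := by
    simp only [hZ, sampleMean]
    rw [integral_const_mul, integral_finsetSum _ fun i _ => (hYm i).integrable (by norm_num)]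
    rw [Finset.sum_congr rfl fun i _ => (hid i).integral_eq]
    rw [Finset.sum_const, Finset.card_range, nsmul_eq_mul]
    field_simp
  have hvar : variance Z P = variance (fun ω => h x (X 0 ω)) P / n := by
    have : Z = fun ω => (1 / (n : ℝ)) * (∑ i ∈ Finset.range n, fun ω => h x (X i ω)) ω := by
      rw [← hsum]; rfl
    rw [this, variance_const_mul, IndepFun.variance_sum (fun i _ => hYm i)]
    · rw [Finset.sum_congr rfl fun i _ => (hid i).variance_eq]
      rw [Finset.sum_const, Finset.card_range, nsmul_eq_mul]
      field_simp
    · intro i _ j _ hij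
      exact (hindep.indepFun hij).comp hh hh
  have hZi := hZm.integrable (by norm_num)
  have hZ2 := hZm.integrable_sq
  have e1 : variance Z P = ∫ ω, Z ω ^ 2 ∂P - (∫ ω, Z ω ∂P) ^ 2 := variance_eq_sub hZm
  have e2 : variance (fun ω => h x (X 0 ω)) P
      = ∫ ω, h x (X 0 ω) ^ 2 ∂P - (∫ ω, h x (X 0 ω) ∂P) ^ 2 := variance_eq_sub (hYm 0)
  have e3 : mse P F (sampleMean h X n) x
      = ∫ ω, Z ω ^ 2 ∂P - 2 * F x * (∫ ω, Z ω ∂P) + F x ^ 2 := by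
    have : ∀ ω, (Z ω - F x) ^ 2 = Z ω ^ 2 - 2 * F x * Z ω + F x ^ 2 := fun ω => by ring
    unfold mse
    change ∫ ω, (Z ω - F x) ^ 2 ∂P = _
    simp_rw [this]
    rw [integral_add (by exact hZ2.sub (hZi.const_mul _)) (integrable_const _),
      integral_sub hZ2 (hZi.const_mul _), integral_const_mul]
    simp
  rw [e3, ← e2]
  rw [hvar, hmean] at e1
  rw [e1, hmean]
  ring

lemma mse_edf (hX : ∀ i, Measurable (X i)) (hindep : iIndepFun X P)
    (hF : ∀ i x, P.real {ω | X i ω ≤ x} = F x) {n : ℕ} (hn : 0 < n) (x : ℝ) :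
    mse P F (edf X n) x = sigmaSq F x / n := by
  rw [edf_eq_sampleMean, mse_sampleMean hX hindep hF (measurable_edfKernel_right x)
    (fun t => edfKernel_mem x t) hn]
  simp_rw [sq (edfKernel _ _), edfKernel_mul, min_self]
  rw [integral_edfKernel hX hF]
  unfold sigmaSq
  ring

lemma integral_szaszKernel (hX : ∀ i, Measurable (X i))
    (hF : ∀ i x, P.real {ω | X i ω ≤ x} = F x) (m : ℕ) {x : ℝ} (hx : 0 ≤ x) :
    ∫ ω, szaszKernel m x (X 0 ω) ∂P = poissonMean m x F := by
  simp_rw [szaszKernel_eq_integral m hx]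
  rw [integral_integral_swap]
  · simp_rw [integral_edfKernel hX hF]
    rfl
  · refine Integrable.of_bound (C := 1) ?_ (Eventually.of_forall fun p => ?_)
    · apply Measurable.aestronglyMeasurable
      exact measurable_edfKernel.comp (((hX 0).comp measurable_fst).prodMk
        ((Measurable.of_discrete (f := fun k : ℕ => (k : ℝ) / m)).comp measurable_snd))
    · simp only [Function.uncurry_def]
      rw [Real.norm_of_nonneg (edfKernel_mem _ _).1]
      exact (edfKernel_mem _ _).2

/-- A squared expectation is an expectation over two independent copies, and a product of two
indicators `1{t ≤ ·}` is the indicator at the minimum. -/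
lemma integral_szaszKernel_sq (hX : ∀ i, Measurable (X i))
    (hF : ∀ i x, P.real {ω | X i ω ≤ x} = F x) (m : ℕ) {x : ℝ} (hx : 0 ≤ x) :
    ∫ ω, szaszKernel m x (X 0 ω) ^ 2 ∂P = poissonMinMean m x F := by
  have e : ∀ t, szaszKernel m x t ^ 2 = ∫ p : ℕ × ℕ, edfKernel ((min p.1 p.2 : ℕ) / m) t
      ∂((poissonMeasure (m * x).toNNReal).prod (poissonMeasure (m * x).toNNReal)) := by
    intro t
    rw [szaszKernel_eq_integral m hx, sq, ← integral_prod_mul]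
    congr 1
    funext p
    rw [edfKernel_mul, Nat.cast_min, min_div_div_right (by positivity)]
  simp_rw [e]
  rw [integral_integral_swap]
  · simp_rw [integral_edfKernel hX hF]
    rfl
  · refine Integrable.of_bound (C := 1) ?_ (Eventually.of_forall fun p => ?_)
    · apply Measurable.aestronglyMeasurable
      exact measurable_edfKernel.comp (((hX 0).comp measurable_fst).prodMk
        ((Measurable.of_discrete (f := fun p : ℕ × ℕ => ((min p.1 p.2 : ℕ) : ℝ) / m)).comp
          measurable_snd))
    · simp only [Function.uncurry_def]
      rw [Real.norm_of_nonneg (edfKernel_mem _ _).1]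
      exact (edfKernel_mem _ _).2

lemma mse_szasz (hX : ∀ i, Measurable (X i)) (hindep : iIndepFun X P)
    (hF : ∀ i x, P.real {ω | X i ω ≤ x} = F x) (m : ℕ) {n : ℕ} (hn : 0 < n) {x : ℝ}
    (hx : 0 ≤ x) :
    mse P F (szasz X m n) x = szaszVar F m x / n + (poissonMean m x F - F x) ^ 2 := by
  rw [szasz_eq_sampleMean, mse_sampleMean hX hindep hF
    ((measurable_szaszKernel m).comp (measurable_id.prodMk measurable_const))
    (fun t => szaszKernel_mem m hx t) hn, integral_szaszKernel hX hF m hx,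
    integral_szaszKernel_sq hX hF m hx]
  rfl

/-- Fubini: both the estimator and `F` lie in `[0, 1]`, so the weight itself dominates the
integrand. -/
lemma mise_sampleMean (hX : ∀ i, Measurable (X i)) {h : ℝ → ℝ → ℝ}
    (hh : Measurable (fun p : ℝ × ℝ => h p.2 p.1))
    (h01 : ∀ x, 0 < x → ∀ t, 0 ≤ h x t ∧ h x t ≤ 1)
    (hFm : Measurable F) (hF01 : ∀ x, 0 ≤ F x ∧ F x ≤ 1) {f : ℝ → ℝ} {a : ℝ}
    (hw : IntegrableOn (fun x => Real.exp (-(a * x)) * f x) (Ioi 0)) {n : ℕ} (hn : 0 < n) :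
    mise P F f a (sampleMean h X n)
      = ∫ x in Ioi 0, mse P F (sampleMean h X n) x * (Real.exp (-(a * x)) * f x) := by
  unfold mise mse
  rw [integral_integral_swap]
  · simp_rw [integral_mul_const]
  · have hw2 : Integrable (fun p : Ω × ℝ => Real.exp (-(a * p.2)) * f p.2)
        (P.prod (volume.restrict (Ioi 0))) := by
      exact Integrable.comp_snd (f := fun x => Real.exp (-(a * x)) * f x) hw P
    refine hw2.norm.mono' (AEStronglyMeasurable.mul ?_ hw2.aestronglyMeasurable) ?_
    · exact (((measurable_sampleMean hh hX n).sub
        (hFm.comp measurable_snd)).pow_const 2).aestronglyMeasurable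
    · have hae : ∀ᵐ q ∂(P.prod (volume.restrict (Ioi (0 : ℝ)))), q.2 ∈ Ioi (0 : ℝ) :=
        Measure.quasiMeasurePreserving_snd.ae (ae_restrict_mem measurableSet_Ioi)
      filter_upwards [hae] with q hq
      simp only [Function.uncurry_def]
      rw [norm_mul]
      refine mul_le_of_le_one_left (norm_nonneg _) ?_
      have h1 := sampleMean_mem (h01 q.2 hq) X hn q.1
      have h2 := hF01 q.2
      rw [Real.norm_of_nonneg (sq_nonneg _), sq_le_one_iff_abs_le_one, abs_le]
      constructor <;> linarith [h1.1, h1.2, h2.1, h2.2]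

/-- On the half line the function is the `ω`-integral of the jointly measurable kernel, hence
measurable in `x`. -/
lemma aestronglyMeasurable_poissonMean (hX : ∀ i, Measurable (X i))
    (hF : ∀ i x, P.real {ω | X i ω ≤ x} = F x) (m : ℕ) :
    AEStronglyMeasurable (fun x => poissonMean m x F) (volume.restrict (Ioi 0)) := by
  have hm : Measurable (fun p : Ω × ℝ => szaszKernel m p.2 (X 0 p.1)) :=
    (measurable_szaszKernel m).comp (((hX 0).comp measurable_fst).prodMk measurable_snd)
  have := hm.stronglyMeasurable.integral_prod_left' (μ := P)
  refine this.aestronglyMeasurable.congr ?_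
  filter_upwards [ae_restrict_mem measurableSet_Ioi] with x hx
  exact integral_szaszKernel hX hF m (le_of_lt hx)

lemma aestronglyMeasurable_poissonMinMean (hX : ∀ i, Measurable (X i))
    (hF : ∀ i x, P.real {ω | X i ω ≤ x} = F x) (m : ℕ) :
    AEStronglyMeasurable (fun x => poissonMinMean m x F) (volume.restrict (Ioi 0)) := by
  have hm : Measurable (fun p : Ω × ℝ => szaszKernel m p.2 (X 0 p.1) ^ 2) :=
    ((measurable_szaszKernel m).comp
      (((hX 0).comp measurable_fst).prodMk measurable_snd)).pow_const 2
  have := hm.stronglyMeasurable.integral_prod_left' (μ := P)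
  refine this.aestronglyMeasurable.congr ?_
  filter_upwards [ae_restrict_mem measurableSet_Ioi] with x hx
  exact integral_szaszKernel_sq hX hF m (le_of_lt hx)

lemma aestronglyMeasurable_szaszVar (hX : ∀ i, Measurable (X i))
    (hF : ∀ i x, P.real {ω | X i ω ≤ x} = F x) (m : ℕ) :
    AEStronglyMeasurable (fun x => szaszVar F m x) (volume.restrict (Ioi 0)) :=
  (aestronglyMeasurable_poissonMinMean hX hF m).sub
    ((aestronglyMeasurable_poissonMean hX hF m).pow 2)

end SampleMean

/-! ### Asymptotics of the matching sample size -/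

lemma EqTimesAddLittleO.of_tendsto_div {u r : ℕ → ℝ} {ℓ : ℝ} (hr : ∀ᶠ n in atTop, r n ≠ 0)
    (h : Tendsto (fun n => u n / r n) atTop (𝓝 ℓ)) : EqTimesAddLittleO u r ℓ := by
  refine ⟨fun n => u n / r n - ℓ, by simpa using h.sub_const ℓ, ?_⟩
  filter_upwards [hr] with n hn
  field_simp
  ring

/-- The admissible sizes are exactly those `k ≥ s/A`, so the minimum exists and `sInf` does not take
its default value. The clause `1 ≤ k` excludes `k = 0`, where `s / 0 = 0` would satisfy the
inequality. -/
lemma sInf_div_le_eq_ceil {s A : ℝ} (hs : 0 < s) (hA : 0 < A) :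
    sInf {k : ℕ | 1 ≤ k ∧ s / k ≤ A} = ⌈s / A⌉₊ := by
  have : {k : ℕ | 1 ≤ k ∧ s / k ≤ A} = Ici ⌈s / A⌉₊ := by
    ext k
    rw [mem_Ici, Nat.ceil_le, div_le_iff₀ hA]
    constructor
    · rintro ⟨hk, h⟩
      have hk' : (0 : ℝ) < k := by exact_mod_cast hk
      rw [div_le_iff₀ hk'] at h
      linarith
    · intro h
      have hk' : (0 : ℝ) < k := by
        by_contra hk
        push Not at hk
        nlinarith
      refine ⟨by exact_mod_cast hk', ?_⟩
      rw [div_le_iff₀ hk']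
      linarith
  rw [this, csInf_Ici]

/-- The error to be matched is `s δ/n`, so `i = ⌈n/δ⌉` and `(n/δ - n)/(n r) = (1 - δ)/(r δ)`. Here
`p` and `q` measure the variance gain and the squared bias on the relative scale `r`; `hρ` makes `δ
→ 1`, and `hnr` makes the rounding up negligible. -/
lemma tendsto_matching_sub_div {m : ℕ → ℕ} (hm : Tendsto m atTop atTop) {s v β : ℝ} (hs : 0 < s)
    {vs βs : ℕ → ℝ} (hv : Tendsto vs atTop (𝓝 v)) (hβ : Tendsto βs atTop (𝓝 β)) {i : ℕ → ℕ}
    (hi : ∀ᶠ n in atTop, i n = sInf {k : ℕ | 1 ≤ k ∧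
      s / k ≤ (s - (Real.sqrt (m n))⁻¹ * vs (m n)) / n + βs (m n) / (m n : ℝ) ^ 2})
    {r : ℕ → ℝ} (hr : ∀ᶠ n in atTop, 0 < r n) {p q : ℝ}
    (hp : Tendsto (fun n => (Real.sqrt (m n))⁻¹ / r n) atTop (𝓝 p))
    (hq : Tendsto (fun n : ℕ => (n : ℝ) / (m n : ℝ) ^ 2 / r n) atTop (𝓝 q))
    (hρ : Tendsto (fun n : ℕ => (n : ℝ) / (m n : ℝ) ^ 2) atTop (𝓝 0))
    (hnr : Tendsto (fun n : ℕ => 1 / ((n : ℝ) * r n)) atTop (𝓝 0)) :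
    Tendsto (fun n : ℕ => ((i n : ℝ) - n) / (n * r n)) atTop (𝓝 ((p * v - q * β) / s)) := by
  have hsqrt : Tendsto (fun n => (Real.sqrt (m n))⁻¹) atTop (𝓝 0) :=
    tendsto_inv_atTop_zero.comp (Real.tendsto_sqrt_atTop.comp
      (tendsto_natCast_atTop_atTop.comp hm))
  have hvm : Tendsto (fun n => vs (m n)) atTop (𝓝 v) := hv.comp hm
  have hβm : Tendsto (fun n => βs (m n)) atTop (𝓝 β) := hβ.comp hm
  set δ : ℕ → ℝ := fun n => 1 - (Real.sqrt (m n))⁻¹ * vs (m n) / s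
    + (n : ℝ) / (m n : ℝ) ^ 2 * βs (m n) / s with hδ
  have hδ1 : Tendsto δ atTop (𝓝 1) := by
    have := (((hsqrt.mul hvm).div_const s).const_sub 1).add ((hρ.mul hβm).div_const s)
    simpa using this
  set E : ℕ → ℝ := fun n => ((Real.sqrt (m n))⁻¹ / r n * vs (m n)
    - (n : ℝ) / (m n : ℝ) ^ 2 / r n * βs (m n)) / s / δ n with hE
  have hEl : Tendsto E atTop (𝓝 ((p * v - q * β) / s)) := by
    have := (((hp.mul hvm).sub (hq.mul hβm)).div_const s).div hδ1 one_ne_zero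
    rwa [div_one] at this
  have hbounds : ∀ᶠ n : ℕ in atTop, E n ≤ ((i n : ℝ) - n) / (n * r n) ∧
      ((i n : ℝ) - n) / (n * r n) ≤ E n + 1 / ((n : ℝ) * r n) := by
    filter_upwards [hi, hr, hδ1.eventually_const_lt zero_lt_one, eventually_gt_atTop 0]
      with n hin hrn hδn hn
    have hn' : (0 : ℝ) < n := by exact_mod_cast hn
    have hA : (s - (Real.sqrt (m n))⁻¹ * vs (m n)) / n + βs (m n) / (m n : ℝ) ^ 2
        = s * δ n / n := by
      simp only [hδ]
      field_simp
    have hApos : 0 < s * δ n / n := by positivity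
    rw [hA, sInf_div_le_eq_ceil hs hApos] at hin
    have hdiv : s / (s * δ n / n) = n / δ n := by field_simp
    rw [hdiv] at hin
    have h1 : (n : ℝ) / δ n ≤ i n := by rw [hin]; exact Nat.le_ceil _
    have h2 : (i n : ℝ) < n / δ n + 1 := by rw [hin]; exact Nat.ceil_lt_add_one (by positivity)
    have hEn : E n = (n / δ n - n) / (n * r n) := by
      have : E n = ((1 - δ n) / r n) / δ n := by
        simp only [hE]
        congr 1
        simp only [hδ]
        field_simp
        ring
      rw [this]
      field_simp
    rw [hEn, ← add_div]
    constructor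
    · gcongr
    · gcongr
      linarith
  refine tendsto_of_tendsto_of_tendsto_of_le_of_le' hEl ?_ (hbounds.mono fun n h => h.1)
    (hbounds.mono fun n h => h.2)
  simpa using hEl.add hnr

/-- The asymptotics of the matching sample size in the three regimes of `m`. -/
lemma matching_asymptotics {m : ℕ → ℕ} (hm : Tendsto m atTop atTop) {s v β : ℝ} (hs : 0 < s)
    {vs βs : ℕ → ℝ} (hv : Tendsto vs atTop (𝓝 v)) (hβ : Tendsto βs atTop (𝓝 β)) {i : ℕ → ℕ}
    (hi : ∀ᶠ n in atTop, i n = sInf {k : ℕ | 1 ≤ k ∧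
      s / k ≤ (s - (Real.sqrt (m n))⁻¹ * vs (m n)) / n + βs (m n) / (m n : ℝ) ^ 2}) :
    (Tendsto (fun n : ℕ => (m n : ℝ) * (n : ℝ) ^ (-(1 / 2) : ℝ)) atTop atTop →
      EqTimesAddLittleO (fun n => (i n : ℝ)) (fun n => (n : ℝ)) 1) ∧
    (Tendsto (fun n : ℕ => (m n : ℝ) * (n : ℝ) ^ (-(2 / 3) : ℝ)) atTop atTop →
      Tendsto (fun n : ℕ => (m n : ℝ) * (n : ℝ) ^ (-2 : ℝ)) atTop (𝓝 0) →
      EqTimesAddLittleO (fun n => (i n : ℝ) - (n : ℝ))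
        (fun n => (m n : ℝ) ^ (-(1 / 2) : ℝ) * (n : ℝ)) (v / s)) ∧
    (∀ c : ℝ, 0 < c →
      Tendsto (fun n : ℕ => (m n : ℝ) * (n : ℝ) ^ (-(2 / 3) : ℝ)) atTop (𝓝 c) →
      EqTimesAddLittleO (fun n => (i n : ℝ) - (n : ℝ)) (fun n => (n : ℝ) ^ (2 / 3 : ℝ))
        (c ^ (-(1 / 2) : ℝ) * (v / s) - c ^ (-2 : ℝ) * (β / s))) := by
  have hsqrt : Tendsto (fun n => (Real.sqrt (m n))⁻¹) atTop (𝓝 0) :=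
    tendsto_inv_atTop_zero.comp (Real.tendsto_sqrt_atTop.comp
      (tendsto_natCast_atTop_atTop.comp hm))
  have hmpos : ∀ᶠ n in atTop, 0 < m n := hm.eventually_gt_atTop 0
  have hsq : ∀ y : ℝ, 0 < y → (Real.sqrt y)⁻¹ = y ^ (-(1 / 2) : ℝ) := fun y hy => by
    rw [Real.sqrt_eq_rpow, Real.rpow_neg hy.le]
  refine ⟨fun h => ?_, fun h h2 => ?_, fun c hc h => ?_⟩
  -- `n/m²` is the inverse square of `m n^(-1/2)`.
  · have hρ : Tendsto (fun n : ℕ => (n : ℝ) / (m n : ℝ) ^ 2) atTop (𝓝 0) := by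
      have h3 := (tendsto_inv_atTop_zero.comp h).pow 2
      rw [zero_pow two_ne_zero] at h3
      refine h3.congr' ?_
      filter_upwards [eventually_gt_atTop 0, hmpos] with n hn hmn
      have hn' : (0 : ℝ) < n := by exact_mod_cast hn
      simp only [Function.comp]
      rw [← hsq _ hn']
      have : Real.sqrt n ^ 2 = n := Real.sq_sqrt hn'.le
      rw [mul_inv, inv_inv, mul_pow, this, inv_pow]
      ring
    -- On the scale `r = 1` both corrections vanish.
    have key := tendsto_matching_sub_div hm hs hv hβ hi (r := fun _ => 1) (p := 0) (q := 0)
      (by simp) (by simpa using hsqrt) (by simpa using hρ) hρ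
      (by simpa using tendsto_inv_atTop_nhds_zero_nat (𝕜 := ℝ))
    have key1 := key.const_add 1
    refine EqTimesAddLittleO.of_tendsto_div ?_ ?_
    · filter_upwards [eventually_gt_atTop 0] with n hn
      positivity
    · simp only [zero_mul, sub_zero, zero_div, add_zero, mul_one] at key1
      refine key1.congr' ?_
      filter_upwards [eventually_gt_atTop 0] with n hn
      have hn' : (0 : ℝ) < n := by exact_mod_cast hn
      field_simp
      ring
  -- Relative to `r = m^(-1/2)` the bias term is `n m^(-3/2) = (m n^(-2/3))^(-3/2)`, so it drops
  -- out.
  · have hq : Tendsto (fun n : ℕ => (n : ℝ) / (m n : ℝ) ^ 2 / (m n : ℝ) ^ (-(1 / 2) : ℝ)) atTop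
        (𝓝 0) := by
      have h3 := (tendsto_rpow_neg_atTop (y := 3 / 2) (by norm_num)).comp h
      refine h3.congr' ?_
      filter_upwards [eventually_gt_atTop 0, hmpos] with n hn hmn
      have hn' : (0 : ℝ) < n := by exact_mod_cast hn
      have hm' : (0 : ℝ) < m n := by exact_mod_cast hmn
      simp only [Function.comp]
      have e : (m n : ℝ) ^ (-(3 / 2) : ℝ) = ((m n : ℝ) ^ 2 * (m n : ℝ) ^ (-(1 / 2) : ℝ))⁻¹ := by
        rw [← Real.rpow_two, ← Real.rpow_add hm', ← Real.rpow_neg hm'.le]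
        norm_num
      have e' : (-(2 / 3) : ℝ) * -(3 / 2) = 1 := by norm_num
      rw [Real.mul_rpow hm'.le (by positivity), ← Real.rpow_mul hn'.le, div_div, e, e',
        Real.rpow_one, inv_mul_eq_div]
    have hr0 : Tendsto (fun n => (m n : ℝ) ^ (-(1 / 2) : ℝ)) atTop (𝓝 0) :=
      hsqrt.congr' (hmpos.mono fun n hn => hsq _ (by exact_mod_cast hn))
    have hρ : Tendsto (fun n : ℕ => (n : ℝ) / (m n : ℝ) ^ 2) atTop (𝓝 0) := by
      have := hq.mul hr0
      rw [zero_mul] at this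
      refine this.congr' ?_
      filter_upwards [hmpos] with n hmn
      have hm' : (0 : ℝ) < m n := by exact_mod_cast hmn
      exact div_mul_cancel₀ _ (Real.rpow_pos_of_pos hm' _).ne'
    -- The rounding error relative to `n m^(-1/2)` is `√(m n^(-2))`; this is where `m n^(-2) → 0`
    -- enters.
    have hnr : Tendsto (fun n : ℕ => 1 / ((n : ℝ) * (m n : ℝ) ^ (-(1 / 2) : ℝ))) atTop (𝓝 0) := by
      have h3 := (Real.continuous_sqrt.tendsto 0).comp h2
      rw [Real.sqrt_zero] at h3
      refine h3.congr' ?_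
      filter_upwards [eventually_gt_atTop 0, hmpos] with n hn hmn
      have hn' : (0 : ℝ) < n := by exact_mod_cast hn
      have hm' : (0 : ℝ) < m n := by exact_mod_cast hmn
      simp only [Function.comp]
      rw [← hsq _ hm', Real.sqrt_mul hm'.le, Real.rpow_neg hn'.le, Real.sqrt_inv,
        Real.rpow_two, Real.sqrt_sq hn'.le]
      field_simp
    have key := tendsto_matching_sub_div hm hs hv hβ hi (p := 1) (q := 0)
      (hmpos.mono fun n hn => Real.rpow_pos_of_pos (by exact_mod_cast hn) _)
      (tendsto_const_nhds.congr' (hmpos.mono fun n hn => by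
        have hm' : (0 : ℝ) < m n := by exact_mod_cast hn
        simp only
        rw [hsq _ hm', div_self (Real.rpow_pos_of_pos hm' _).ne'])) hq hρ hnr
    refine EqTimesAddLittleO.of_tendsto_div ?_ ?_
    · filter_upwards [eventually_gt_atTop 0, hmpos] with n hn hmn
      have hm' : (0 : ℝ) < m n := by exact_mod_cast hmn
      have := Real.rpow_pos_of_pos hm' (-(1 / 2))
      positivity
    · simp only [zero_mul, sub_zero, one_mul] at key
      exact key.congr fun n => by rw [mul_comm (n : ℝ)]
  -- With `m ~ c n^(2/3)` both `m^(-1/2)` and `n/m²` have order `n^(-1/3)`, so `r = n^(-1/3)` and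
  -- both corrections survive.
  · have hrpos : ∀ᶠ n : ℕ in atTop, (0 : ℝ) < (n : ℝ) ^ (-(1 / 3) : ℝ) := by
      filter_upwards [eventually_gt_atTop 0] with n hn
      exact Real.rpow_pos_of_pos (by exact_mod_cast hn) _
    have hp : Tendsto (fun n : ℕ => (Real.sqrt (m n))⁻¹ / (n : ℝ) ^ (-(1 / 3) : ℝ)) atTop
        (𝓝 (c ^ (-(1 / 2) : ℝ))) := by
      refine (h.rpow_const (p := -(1 / 2)) (Or.inl hc.ne')).congr' ?_
      filter_upwards [eventually_gt_atTop 0, hmpos] with n hn hmn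
      have hn' : (0 : ℝ) < n := by exact_mod_cast hn
      have hm' : (0 : ℝ) < m n := by exact_mod_cast hmn
      have e' : (-(2 / 3) : ℝ) * -(1 / 2) = -(-(1 / 3)) := by norm_num
      rw [hsq _ hm', Real.mul_rpow hm'.le (by positivity), ← Real.rpow_mul hn'.le, e',
        Real.rpow_neg hn'.le (-(1 / 3)), ← div_eq_mul_inv]
    have hq : Tendsto (fun n : ℕ => (n : ℝ) / (m n : ℝ) ^ 2 / (n : ℝ) ^ (-(1 / 3) : ℝ)) atTop
        (𝓝 (c ^ (-2 : ℝ))) := by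
      refine (h.rpow_const (p := -2) (Or.inl hc.ne')).congr' ?_
      filter_upwards [eventually_gt_atTop 0, hmpos] with n hn hmn
      have hn' : (0 : ℝ) < n := by exact_mod_cast hn
      have hm' : (0 : ℝ) < m n := by exact_mod_cast hmn
      rw [Real.mul_rpow hm'.le (by positivity), ← Real.rpow_mul hn'.le, div_right_comm]
      nth_rw 2 [← Real.rpow_one (n : ℝ)]
      rw [← Real.rpow_sub hn', Real.rpow_neg hm'.le, Real.rpow_two]
      norm_num
      ring
    have hr0 : Tendsto (fun n : ℕ => (n : ℝ) ^ (-(1 / 3) : ℝ)) atTop (𝓝 0) :=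
      (tendsto_rpow_neg_atTop (y := 1 / 3) (by norm_num)).comp tendsto_natCast_atTop_atTop
    have hρ : Tendsto (fun n : ℕ => (n : ℝ) / (m n : ℝ) ^ 2) atTop (𝓝 0) := by
      have := hq.mul hr0
      rw [mul_zero] at this
      refine this.congr' ?_
      filter_upwards [hrpos] with n hn
      exact div_mul_cancel₀ _ hn.ne'
    have hnr_eq : ∀ᶠ n : ℕ in atTop, (n : ℝ) * (n : ℝ) ^ (-(1 / 3) : ℝ) = (n : ℝ) ^ (2 / 3 : ℝ) := by
      filter_upwards [eventually_gt_atTop 0] with n hn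
      have hn' : (0 : ℝ) < n := by exact_mod_cast hn
      nth_rw 1 [← Real.rpow_one (n : ℝ)]
      rw [← Real.rpow_add hn']
      norm_num
    have hnr : Tendsto (fun n : ℕ => 1 / ((n : ℝ) * (n : ℝ) ^ (-(1 / 3) : ℝ))) atTop (𝓝 0) := by
      have h3 : Tendsto (fun n : ℕ => (n : ℝ) ^ (-(2 / 3) : ℝ)) atTop (𝓝 0) :=
        (tendsto_rpow_neg_atTop (y := 2 / 3) (by norm_num)).comp tendsto_natCast_atTop_atTop
      refine h3.congr' ?_
      filter_upwards [hnr_eq] with n hn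
      rw [hn, Real.rpow_neg (Nat.cast_nonneg n), one_div]
    have key := tendsto_matching_sub_div hm hs hv hβ hi hrpos hp hq hρ hnr
    refine EqTimesAddLittleO.of_tendsto_div ?_ ?_
    · filter_upwards [eventually_gt_atTop 0] with n hn
      exact (Real.rpow_pos_of_pos (by exact_mod_cast hn) _).ne'
    · have e : (c ^ (-(1 / 2) : ℝ) * v - c ^ (-2 : ℝ) * β) / s
          = c ^ (-(1 / 2) : ℝ) * (v / s) - c ^ (-2 : ℝ) * (β / s) := by ring
      rw [e] at key
      refine key.congr' ?_
      filter_upwards [hnr_eq] with n hn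
      rw [hn]

/-! ### The integrated error -/

section Global

variable {F f f' : ℝ → ℝ} {B L a : ℝ}

/-- Boundedness of `f` leaves a Gamma-type integral. The powers `0`, `1`, `2` dominate the variance
gain and the squared bias. -/
lemma integrableOn_pow_mul_weight (ha : 0 < a) (hf_cont : ContinuousOn f (Ici 0))
    (hL : ∀ x ∈ Ici (0 : ℝ), |f x| ≤ L) (k : ℕ) :
    IntegrableOn (fun x => x ^ k * (Real.exp (-(a * x)) * f x)) (Ioi 0) := by
  have h := integrableOn_rpow_mul_exp_neg_mul_rpow (p := 1) (s := k) (b := a)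
    (by linarith [(Nat.cast_nonneg k : (0 : ℝ) ≤ k)]) one_pos ha
  have hk : IntegrableOn (fun x : ℝ => L * (x ^ k * Real.exp (-(a * x)))) (Ioi 0) := by
    refine (h.congr_fun (fun x _ => ?_) measurableSet_Ioi).const_mul L
    simp only [Real.rpow_natCast, Real.rpow_one, neg_mul]
  refine hk.mono' ?_ ?_
  · have hfm := (hf_cont.mono Ioi_subset_Ici_self).aestronglyMeasurable
      (μ := volume) measurableSet_Ioi
    have h1 : AEStronglyMeasurable (fun x : ℝ => x ^ k) (volume.restrict (Ioi 0)) :=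
      (by fun_prop : Measurable fun x : ℝ => x ^ k).aestronglyMeasurable
    have h2 : AEStronglyMeasurable (fun x : ℝ => Real.exp (-(a * x))) (volume.restrict (Ioi 0)) :=
      (by fun_prop : Measurable fun x : ℝ => Real.exp (-(a * x))).aestronglyMeasurable
    exact h1.mul (h2.mul hfm)
  · filter_upwards [ae_restrict_mem measurableSet_Ioi] with x hx
    have hx0 : 0 < x := hx
    have := hL x hx0.le
    rw [norm_mul, norm_mul, Real.norm_of_nonneg (by positivity : 0 ≤ x ^ k),
      Real.norm_of_nonneg (Real.exp_pos _).le, Real.norm_eq_abs]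
    have h2 : 0 < Real.exp (-(a * x)) := Real.exp_pos _
    calc x ^ k * (Real.exp (-(a * x)) * |f x|) ≤ x ^ k * (Real.exp (-(a * x)) * L) := by gcongr
      _ = L * (x ^ k * Real.exp (-(a * x))) := by ring

lemma sigmaSq_mem (hF01 : ∀ x, 0 ≤ F x ∧ F x ≤ 1) (x : ℝ) :
    0 ≤ sigmaSq F x ∧ sigmaSq F x ≤ 1 := by
  unfold sigmaSq
  have := hF01 x
  constructor
  · nlinarith
  · nlinarith

lemma integrableOn_sigmaSq_mul_weight (ha : 0 < a) (hF01 : ∀ x, 0 ≤ F x ∧ F x ≤ 1)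
    (hF_cont : Continuous F) (hf_cont : ContinuousOn f (Ici 0))
    (hL : ∀ x ∈ Ici (0 : ℝ), |f x| ≤ L) :
    IntegrableOn (fun x => sigmaSq F x * (Real.exp (-(a * x)) * f x)) (Ioi 0) := by
  have hw := integrableOn_pow_mul_weight ha hf_cont hL 0
  simp only [pow_zero, one_mul] at hw
  refine Integrable.bdd_mul (c := 1) hw ?_ ?_
  · unfold sigmaSq
    exact (by fun_prop : Continuous fun x => F x * (1 - F x)).aestronglyMeasurable
  · filter_upwards with x
    rw [Real.norm_of_nonneg (sigmaSq_mem hF01 x).1]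
    exact (sigmaSq_mem hF01 x).2

lemma density_nonneg (hmono : Monotone F)
    (hf : ∀ x ∈ Ici (0 : ℝ), HasDerivWithinAt F (f x) (Ici 0) x) {x : ℝ} (hx : 0 < x) :
    0 ≤ f x := by
  have h := (hf x hx.le).hasDerivAt (Ici_mem_nhds hx)
  rw [← h.deriv]
  exact hmono.deriv_nonneg

/-- If the integral vanished, so would the continuous nonnegative integrand, hence `F (1 - F) f`,
the derivative of `F²/2 - F³/3`. That function would be constant on `[0, ∞)`, yet it starts at `0`
and tends to `1/6`. -/
lemma C1_pos (ha : 0 < a) (hF01 : ∀ x, 0 ≤ F x ∧ F x ≤ 1) (hmono : Monotone F)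
    (hlim : Tendsto F atTop (𝓝 1)) (hF_neg : ∀ x < 0, F x = 0) (hF_cont : Continuous F)
    (hf : ∀ x ∈ Ici (0 : ℝ), HasDerivWithinAt F (f x) (Ici 0) x)
    (hf_cont : ContinuousOn f (Ici 0)) (hL : ∀ x ∈ Ici (0 : ℝ), |f x| ≤ L) : 0 < C1 F f a := by
  have hnn : ∀ x ∈ Ioi (0 : ℝ), 0 ≤ sigmaSq F x * (Real.exp (-(a * x)) * f x) := fun x hx =>
    mul_nonneg (sigmaSq_mem hF01 x).1 (mul_nonneg (Real.exp_pos _).le (density_nonneg hmono hf hx))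
  have hae : 0 ≤ᵐ[volume.restrict (Ioi 0)]
      fun x => sigmaSq F x * (Real.exp (-(a * x)) * f x) := by
    filter_upwards [ae_restrict_mem measurableSet_Ioi] with x hx using hnn x hx
  have h0 : 0 ≤ C1 F f a := integral_nonneg_of_ae hae
  refine lt_of_le_of_ne h0 fun heq => ?_
  have hz := (setIntegral_eq_zero_iff_of_nonneg_ae hae
    (integrableOn_sigmaSq_mul_weight ha hF01 hF_cont hf_cont hL)).1 heq.symm
  have hcont : ContinuousOn (fun x => sigmaSq F x * (Real.exp (-(a * x)) * f x)) (Ioi 0) := by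
    unfold sigmaSq
    exact (by fun_prop : Continuous fun x => F x * (1 - F x)).continuousOn.mul
      ((by fun_prop : Continuous fun x => Real.exp (-(a * x))).continuousOn.mul
        (hf_cont.mono Ioi_subset_Ici_self))
  have hEq := Measure.eqOn_open_of_ae_eq hz isOpen_Ioi hcont continuousOn_const
  have hF0 : F 0 = 0 := by
    have h1 : Tendsto F (𝓝[<] 0) (𝓝 (F 0)) := (hF_cont.tendsto 0).mono_left nhdsWithin_le_nhds
    have h2 : Tendsto F (𝓝[<] 0) (𝓝 0) := tendsto_const_nhds.congr' (by
      filter_upwards [self_mem_nhdsWithin] with x hx using (hF_neg x hx).symm)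
    exact tendsto_nhds_unique h1 h2
  have hder : ∀ x ∈ Ici (0 : ℝ), HasDerivWithinAt (fun x => F x ^ 2 / 2 - F x ^ 3 / 3)
      0 (Ici 0) x := by
    intro x hx
    refine ((((hf x hx).pow 2).div_const 2).sub (((hf x hx).pow 3).div_const 3)).congr_deriv ?_
    -- The integrand is known to vanish only on the open half line; at the endpoint `F 0 = 0` is
    -- used.
    have hprod : F x * (1 - F x) * f x = 0 := by
      rcases (mem_Ici.1 hx).eq_or_lt with rfl | hx0
      · simp [hF0]
      · have h1 := hEq hx0
        simp only [sigmaSq, Pi.zero_apply] at h1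
        have h2 := (Real.exp_pos (-(a * x))).ne'
        rcases mul_eq_zero.1 h1 with h3 | h3
        · rw [h3, zero_mul]
        · rw [(mul_eq_zero.1 h3).resolve_left h2, mul_zero]
    push_cast
    linear_combination hprod
  have hconst : ∀ x, 0 ≤ x → F x ^ 2 / 2 - F x ^ 3 / 3 = 0 := by
    intro x hx
    have := abs_sub_le_of_deriv_bound (L := 0) hder (fun x _ => by simp) le_rfl hx
    rw [zero_mul] at this
    have h2 := abs_nonpos_iff.1 this
    rw [hF0] at h2
    simpa using h2
  have hl : Tendsto (fun x => F x ^ 2 / 2 - F x ^ 3 / 3) atTop (𝓝 (1 ^ 2 / 2 - 1 ^ 3 / 3)) :=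
    ((hlim.pow 2).div_const 2).sub ((hlim.pow 3).div_const 3)
  have hl0 : Tendsto (fun x => F x ^ 2 / 2 - F x ^ 3 / 3) atTop (𝓝 0) :=
    tendsto_const_nhds.congr' (by
      filter_upwards [eventually_ge_atTop 0] with x hx using (hconst x hx).symm)
  have := tendsto_nhds_unique hl hl0
  norm_num at this

variable {Ω : Type*} [MeasurableSpace Ω] {P : Measure Ω} [IsProbabilityMeasure P] {X : ℕ → Ω → ℝ}

lemma cdf_properties (hX : ∀ i, Measurable (X i))
    (hF : ∀ i x, P.real {ω | X i ω ≤ x} = F x) :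
    (∀ x, 0 ≤ F x ∧ F x ≤ 1) ∧ Monotone F ∧ Tendsto F atTop (𝓝 1) := by
  have := Measure.isProbabilityMeasure_map (μ := P) (hX 0).aemeasurable
  have hcdf : F = cdf (P.map (X 0)) := by
    funext x
    rw [cdf_eq_real, map_measureReal_apply (hX 0) measurableSet_Iic, ← hF 0 x]
    rfl
  refine ⟨fun x => ?_, ?_, ?_⟩
  · rw [← hF 0 x]
    exact ⟨measureReal_nonneg, measureReal_le_one⟩
  · rw [hcdf]; exact monotone_cdf _
  · rw [hcdf]; exact tendsto_cdf_atTop _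

lemma mise_edf (hX : ∀ i, Measurable (X i)) (hindep : iIndepFun X P)
    (hF : ∀ i x, P.real {ω | X i ω ≤ x} = F x) (hF01 : ∀ x, 0 ≤ F x ∧ F x ≤ 1)
    (hF_cont : Continuous F)
    (hw : IntegrableOn (fun x => Real.exp (-(a * x)) * f x) (Ioi 0)) {n : ℕ} (hn : 0 < n) :
    mise P F f a (edf X n) = C1 F f a / n := by
  rw [edf_eq_sampleMean, mise_sampleMean hX measurable_edfKernel (fun x _ t => edfKernel_mem x t)
    hF_cont.measurable hF01 hw hn, ← edf_eq_sampleMean]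
  simp_rw [mse_edf hX hindep hF hn]
  unfold C1
  rw [← integral_div]
  congr 1
  funext x
  ring

/-- The scaled integrated variance reduction of the Szasz estimator. -/
noncomputable def szaszVarGain (F f : ℝ → ℝ) (a : ℝ) (m : ℕ) : ℝ :=
  ∫ x in Ioi (0 : ℝ), Real.sqrt m * (sigmaSq F x - szaszVar F m x) * (Real.exp (-(a * x)) * f x)

/-- The scaled integrated squared bias of the Szasz estimator. -/
noncomputable def szaszSqBias (F f : ℝ → ℝ) (a : ℝ) (m : ℕ) : ℝ :=
  ∫ x in Ioi (0 : ℝ), ((m : ℝ) * (poissonMean m x F - F x)) ^ 2 * (Real.exp (-(a * x)) * f x)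

lemma aestronglyMeasurable_varGain (hX : ∀ i, Measurable (X i))
    (hF : ∀ i x, P.real {ω | X i ω ≤ x} = F x) (hF_cont : Continuous F)
    (hw : IntegrableOn (fun x => Real.exp (-(a * x)) * f x) (Ioi 0)) (m : ℕ) :
    AEStronglyMeasurable (fun x => Real.sqrt m * (sigmaSq F x - szaszVar F m x)
      * (Real.exp (-(a * x)) * f x)) (volume.restrict (Ioi 0)) := by
  have h1 : AEStronglyMeasurable (sigmaSq F) (volume.restrict (Ioi 0)) := by
    unfold sigmaSq
    exact (by fun_prop : Continuous fun x => F x * (1 - F x)).aestronglyMeasurable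
  exact ((h1.sub (aestronglyMeasurable_szaszVar hX hF m)).const_mul _).mul hw.aestronglyMeasurable

lemma aestronglyMeasurable_sqBias (hX : ∀ i, Measurable (X i))
    (hF : ∀ i x, P.real {ω | X i ω ≤ x} = F x) (hF_cont : Continuous F)
    (hw : IntegrableOn (fun x => Real.exp (-(a * x)) * f x) (Ioi 0)) (m : ℕ) :
    AEStronglyMeasurable (fun x => ((m : ℝ) * (poissonMean m x F - F x)) ^ 2
      * (Real.exp (-(a * x)) * f x)) (volume.restrict (Ioi 0)) :=
  ((((aestronglyMeasurable_poissonMean hX hF m).sub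
    hF_cont.aestronglyMeasurable).const_mul _).pow 2).mul hw.aestronglyMeasurable

lemma norm_varGain_le (hF01 : ∀ x, 0 ≤ F x ∧ F x ≤ 1)
    (hf : ∀ x ∈ Ici (0 : ℝ), HasDerivWithinAt F (f x) (Ici 0) x)
    (hf' : ∀ x ∈ Ici (0 : ℝ), HasDerivWithinAt f (f' x) (Ici 0) x)
    (hL : ∀ x ∈ Ici (0 : ℝ), |f x| ≤ L) (hB : ∀ x ∈ Ici (0 : ℝ), |f' x| ≤ B)
    {m : ℕ} (hm : 0 < m) {x : ℝ} (hx : 0 < x) :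
    ‖Real.sqrt m * (sigmaSq F x - szaszVar F m x) * (Real.exp (-(a * x)) * f x)‖
      ≤ L * ‖x ^ 0 * (Real.exp (-(a * x)) * f x)‖
        + (L + 2 * B) * ‖x ^ 1 * (Real.exp (-(a * x)) * f x)‖ := by
  have h := abs_sqrt_mul_sigmaSq_sub_szaszVar_le hF01 hf hf' hL hB hm hx.le
  rw [norm_mul, Real.norm_eq_abs, norm_mul (x ^ 0), norm_mul (x ^ 1), pow_zero, pow_one, norm_one,
    Real.norm_of_nonneg hx.le]
  have := mul_le_mul_of_nonneg_right h (norm_nonneg (Real.exp (-(a * x)) * f x))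
  linarith

lemma norm_sqBias_le (hF01 : ∀ x, 0 ≤ F x ∧ F x ≤ 1)
    (hf : ∀ x ∈ Ici (0 : ℝ), HasDerivWithinAt F (f x) (Ici 0) x)
    (hf' : ∀ x ∈ Ici (0 : ℝ), HasDerivWithinAt f (f' x) (Ici 0) x)
    (hB : ∀ x ∈ Ici (0 : ℝ), |f' x| ≤ B)
    {m : ℕ} (hm : 0 < m) {x : ℝ} (hx : 0 < x) :
    ‖((m : ℝ) * (poissonMean m x F - F x)) ^ 2 * (Real.exp (-(a * x)) * f x)‖
      ≤ B ^ 2 * ‖x ^ 2 * (Real.exp (-(a * x)) * f x)‖ := by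
  have hm' : (0 : ℝ) < m := by exact_mod_cast hm
  have h := abs_poissonMean_sub_le hF01 hf hf' hB hm hx.le
  have h1 : |(m : ℝ) * (poissonMean m x F - F x)| ≤ B * x := by
    rw [abs_mul, abs_of_pos hm']
    calc (m : ℝ) * |poissonMean m x F - F x| ≤ m * (B * (x / m)) := by gcongr
      _ = B * x := by field_simp
  rw [norm_mul, norm_mul (x ^ 2), Real.norm_of_nonneg (sq_nonneg x), norm_pow, Real.norm_eq_abs,
    ← mul_assoc, ← mul_pow]
  gcongr

lemma tendsto_szaszVarGain (hX : ∀ i, Measurable (X i))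
    (hF : ∀ i x, P.real {ω | X i ω ≤ x} = F x) (hF_cont : Continuous F)
    (hf : ∀ x ∈ Ici (0 : ℝ), HasDerivWithinAt F (f x) (Ici 0) x)
    (hf' : ∀ x ∈ Ici (0 : ℝ), HasDerivWithinAt f (f' x) (Ici 0) x)
    (hf_cont : ContinuousOn f (Ici 0))
    (hL : ∀ x ∈ Ici (0 : ℝ), |f x| ≤ L) (hB : ∀ x ∈ Ici (0 : ℝ), |f' x| ≤ B) (ha : 0 < a) :
    Tendsto (szaszVarGain F f a) atTop (𝓝 (C2 f a)) := by
  have hF01 := (cdf_properties hX hF).1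
  have hw := integrableOn_pow_mul_weight ha hf_cont hL
  have hw0 : IntegrableOn (fun x => Real.exp (-(a * x)) * f x) (Ioi 0) := by simpa using hw 0
  refine tendsto_integral_filter_of_dominated_convergence
    (fun x => L * ‖x ^ 0 * (Real.exp (-(a * x)) * f x)‖
        + (L + 2 * B) * ‖x ^ 1 * (Real.exp (-(a * x)) * f x)‖) ?_ ?_ ?_ ?_
  · exact Eventually.of_forall fun m => aestronglyMeasurable_varGain hX hF hF_cont hw0 m
  · filter_upwards [eventually_gt_atTop 0] with m hm
    filter_upwards [ae_restrict_mem measurableSet_Ioi] with x hx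
    exact norm_varGain_le hF01 hf hf' hL hB hm hx
  · exact ((hw 0).norm.const_mul _).add ((hw 1).norm.const_mul _)
  · filter_upwards [ae_restrict_mem measurableSet_Ioi] with x hx
    exact (tendsto_sqrt_mul_sigmaSq_sub_szaszVar hF01 hf hf' hB hx).mul_const _

lemma tendsto_szaszSqBias (hX : ∀ i, Measurable (X i))
    (hF : ∀ i x, P.real {ω | X i ω ≤ x} = F x) (hF_cont : Continuous F)
    (hf : ∀ x ∈ Ici (0 : ℝ), HasDerivWithinAt F (f x) (Ici 0) x)
    (hf' : ∀ x ∈ Ici (0 : ℝ), HasDerivWithinAt f (f' x) (Ici 0) x)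
    (hf_cont : ContinuousOn f (Ici 0))
    (hL : ∀ x ∈ Ici (0 : ℝ), |f x| ≤ L) (hB : ∀ x ∈ Ici (0 : ℝ), |f' x| ≤ B) (ha : 0 < a) :
    Tendsto (szaszSqBias F f a) atTop (𝓝 (C3 f f' a)) := by
  have hF01 := (cdf_properties hX hF).1
  have hw := integrableOn_pow_mul_weight ha hf_cont hL
  have hw0 : IntegrableOn (fun x => Real.exp (-(a * x)) * f x) (Ioi 0) := by simpa using hw 0
  refine tendsto_integral_filter_of_dominated_convergence
    (fun x => B ^ 2 * ‖x ^ 2 * (Real.exp (-(a * x)) * f x)‖) ?_ ?_ ?_ ?_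
  · exact Eventually.of_forall fun m => aestronglyMeasurable_sqBias hX hF hF_cont hw0 m
  · filter_upwards [eventually_gt_atTop 0] with m hm
    filter_upwards [ae_restrict_mem measurableSet_Ioi] with x hx
    exact norm_sqBias_le hF01 hf hf' hB hm hx
  · exact (hw 2).norm.const_mul _
  · filter_upwards [ae_restrict_mem measurableSet_Ioi] with x hx
    exact ((tendsto_mul_poissonMean_sub hF01 hf hf' hB (le_of_lt hx)).pow 2).mul_const _

/-- The factors `√m` and `m²` are inserted so that the coefficients converge, as
`matching_asymptotics` expects. -/
lemma mse_szasz_eq (hX : ∀ i, Measurable (X i)) (hindep : iIndepFun X P)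
    (hF : ∀ i x, P.real {ω | X i ω ≤ x} = F x) {m n : ℕ} (hm : 0 < m) (hn : 0 < n) {x : ℝ}
    (hx : 0 ≤ x) :
    mse P F (szasz X m n) x
      = (sigmaSq F x - (Real.sqrt m)⁻¹ * (Real.sqrt m * (sigmaSq F x - szaszVar F m x))) / n
        + ((m : ℝ) * (poissonMean m x F - F x)) ^ 2 / (m : ℝ) ^ 2 := by
  have hm' : (0 : ℝ) < m := by exact_mod_cast hm
  have hs0 : Real.sqrt m ≠ 0 := (Real.sqrt_pos.2 hm').ne'
  rw [mse_szasz hX hindep hF m hn hx, inv_mul_cancel_left₀ hs0]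
  field_simp
  ring

lemma mise_szasz_eq (hX : ∀ i, Measurable (X i)) (hindep : iIndepFun X P)
    (hF : ∀ i x, P.real {ω | X i ω ≤ x} = F x) (hF_cont : Continuous F)
    (hf : ∀ x ∈ Ici (0 : ℝ), HasDerivWithinAt F (f x) (Ici 0) x)
    (hf' : ∀ x ∈ Ici (0 : ℝ), HasDerivWithinAt f (f' x) (Ici 0) x)
    (hf_cont : ContinuousOn f (Ici 0))
    (hL : ∀ x ∈ Ici (0 : ℝ), |f x| ≤ L) (hB : ∀ x ∈ Ici (0 : ℝ), |f' x| ≤ B) (ha : 0 < a)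
    {m n : ℕ} (hm : 0 < m) (hn : 0 < n) :
    mise P F f a (szasz X m n)
      = (C1 F f a - (Real.sqrt m)⁻¹ * szaszVarGain F f a m) / n
        + szaszSqBias F f a m / (m : ℝ) ^ 2 := by
  have hF01 := (cdf_properties hX hF).1
  have hw := integrableOn_pow_mul_weight ha hf_cont hL
  have hw0 : IntegrableOn (fun x => Real.exp (-(a * x)) * f x) (Ioi 0) := by simpa using hw 0
  have i1 := integrableOn_sigmaSq_mul_weight ha hF01 hF_cont hf_cont hL
  have i2 : IntegrableOn (fun x => Real.sqrt m * (sigmaSq F x - szaszVar F m x)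
      * (Real.exp (-(a * x)) * f x)) (Ioi 0) := by
    refine (((hw 0).norm.const_mul L).add ((hw 1).norm.const_mul (L + 2 * B))).mono'
      (aestronglyMeasurable_varGain hX hF hF_cont hw0 m) ?_
    filter_upwards [ae_restrict_mem measurableSet_Ioi] with x hx
    exact norm_varGain_le hF01 hf hf' hL hB hm hx
  have i3 : IntegrableOn (fun x => ((m : ℝ) * (poissonMean m x F - F x)) ^ 2
      * (Real.exp (-(a * x)) * f x)) (Ioi 0) := by
    refine ((hw 2).norm.const_mul (B ^ 2)).mono'
      (aestronglyMeasurable_sqBias hX hF hF_cont hw0 m) ?_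
    filter_upwards [ae_restrict_mem measurableSet_Ioi] with x hx
    exact norm_sqBias_le hF01 hf hf' hB hm hx
  rw [szasz_eq_sampleMean, mise_sampleMean hX (measurable_szaszKernel m)
    (fun x hx t => szaszKernel_mem m hx.le t) hF_cont.measurable hF01 hw0 hn,
    ← szasz_eq_sampleMean]
  unfold C1 szaszVarGain szaszSqBias
  rw [← integral_const_mul, ← integral_sub i1 (i2.const_mul _), ← integral_div, ← integral_div,
    ← integral_add (by exact (i1.sub (i2.const_mul _)).div_const _) (i3.div_const _)]
  refine setIntegral_congr_fun measurableSet_Ioi fun x hx => ?_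
  rw [mse_szasz_eq hX hindep hF hm hn (le_of_lt hx)]
  ring

end Global

end SzaszEDF

theorem mainTheorem4
    {Ω : Type*} [MeasurableSpace Ω] (P : Measure Ω) [IsProbabilityMeasure P]
    (X : ℕ → Ω → ℝ) (F f f' : ℝ → ℝ) (a : ℝ) (m : ℕ → ℕ)
    -- i.i.d. observations on the half line with the distribution function `F`
    (hX : ∀ i, Measurable (X i))
    (hindep : iIndepFun X P)
    (hF : ∀ i x, P.real {ω | X i ω ≤ x} = F x)
    (hF_neg : ∀ x < 0, F x = 0)
    -- `F` is continuous; `f = F'` and `f' = F''` are continuous and bounded on `[0, ∞)`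
    (hF_cont : Continuous F)
    (hf : ∀ x ∈ Set.Ici (0 : ℝ), HasDerivWithinAt F (f x) (Set.Ici 0) x)
    (hf' : ∀ x ∈ Set.Ici (0 : ℝ), HasDerivWithinAt f (f' x) (Set.Ici 0) x)
    (hf_cont : ContinuousOn f (Set.Ici 0))
    (hf'_cont : ContinuousOn f' (Set.Ici 0))
    (hf_bdd : ∃ B : ℝ, ∀ x ∈ Set.Ici (0 : ℝ), |f x| ≤ B)
    (hf'_bdd : ∃ B : ℝ, ∀ x ∈ Set.Ici (0 : ℝ), |f' x| ≤ B)
    (ha : 0 < a)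
    (hm : Tendsto m atTop atTop) :
    (Tendsto (fun n : ℕ => (m n : ℝ) * (n : ℝ) ^ (-(1 / 2) : ℝ)) atTop atTop →
      (∀ x : ℝ, 0 < x → 0 < F x → F x < 1 →
        SzaszEDF.EqTimesAddLittleO
          (fun n => (SzaszEDF.iL P X F (m n) n x : ℝ))
          (fun n => (n : ℝ)) 1) ∧
      SzaszEDF.EqTimesAddLittleO
        (fun n => (SzaszEDF.iG P X F f a (m n) n : ℝ))
        (fun n => (n : ℝ)) 1) ∧
    (Tendsto (fun n : ℕ => (m n : ℝ) * (n : ℝ) ^ (-(2 / 3) : ℝ)) atTop atTop →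
      Tendsto (fun n : ℕ => (m n : ℝ) * (n : ℝ) ^ (-2 : ℝ)) atTop (𝓝 0) →
      (∀ x : ℝ, 0 < x → 0 < F x → F x < 1 →
        SzaszEDF.EqTimesAddLittleO
          (fun n => (SzaszEDF.iL P X F (m n) n x : ℝ) - (n : ℝ))
          (fun n => (m n : ℝ) ^ (-(1 / 2) : ℝ) * (n : ℝ))
          (SzaszEDF.thetaS F f x)) ∧
      SzaszEDF.EqTimesAddLittleO
        (fun n => (SzaszEDF.iG P X F f a (m n) n : ℝ) - (n : ℝ))
        (fun n => (m n : ℝ) ^ (-(1 / 2) : ℝ) * (n : ℝ))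
        (SzaszEDF.C2 f a / SzaszEDF.C1 F f a)) ∧
    (∀ c : ℝ, 0 < c →
      Tendsto (fun n : ℕ => (m n : ℝ) * (n : ℝ) ^ (-(2 / 3) : ℝ)) atTop (𝓝 c) →
      (∀ x : ℝ, 0 < x → 0 < F x → F x < 1 →
        SzaszEDF.EqTimesAddLittleO
          (fun n => (SzaszEDF.iL P X F (m n) n x : ℝ) - (n : ℝ))
          (fun n => (n : ℝ) ^ (2 / 3 : ℝ))
          (c ^ (-(1 / 2) : ℝ) * SzaszEDF.thetaS F f x
            - c ^ (-2 : ℝ) * SzaszEDF.gammaS F f' x)) ∧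
      SzaszEDF.EqTimesAddLittleO
        (fun n => (SzaszEDF.iG P X F f a (m n) n : ℝ) - (n : ℝ))
        (fun n => (n : ℝ) ^ (2 / 3 : ℝ))
        (c ^ (-(1 / 2) : ℝ) * (SzaszEDF.C2 f a / SzaszEDF.C1 F f a)
          - c ^ (-2 : ℝ) * (SzaszEDF.C3 f f' a / SzaszEDF.C1 F f a))) := by

  obtain ⟨L, hL⟩ := hf_bdd
  obtain ⟨B, hB⟩ := hf'_bdd
  obtain ⟨hF01, hmono, hlim⟩ := SzaszEDF.cdf_properties hX hF
  have hmpos : ∀ᶠ n in atTop, 0 < m n := hm.eventually_gt_atTop 0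
  -- Here `s = σ²(x)`, `v = V(x)`, `β = b(x)²`; the ratios `v/s` and `β/s` are `thetaS` and `gammaS`
  -- by definition.
  have hloc := fun (x : ℝ) (hx : 0 < x) (h0 : 0 < F x) (h1 : F x < 1) =>
    SzaszEDF.matching_asymptotics (s := SzaszEDF.sigmaSq F x) hm (mul_pos h0 (sub_pos.2 h1))
      (SzaszEDF.tendsto_sqrt_mul_sigmaSq_sub_szaszVar hF01 hf hf' hB hx)
      ((SzaszEDF.tendsto_mul_poissonMean_sub hF01 hf hf' hB hx.le).pow 2)
      (i := fun n => SzaszEDF.iL P X F (m n) n x) (by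
        filter_upwards [hmpos, eventually_gt_atTop 0] with n hmn hn
        unfold SzaszEDF.iL
        congr 1
        ext k
        refine and_congr_right fun hk => ?_
        rw [SzaszEDF.mse_edf hX hindep hF hk, SzaszEDF.mse_szasz_eq hX hindep hF hmn hn hx.le])
  have hw : IntegrableOn (fun x => Real.exp (-(a * x)) * f x) (Ioi 0) := by
    simpa using SzaszEDF.integrableOn_pow_mul_weight ha hf_cont hL 0
  have hglob := SzaszEDF.matching_asymptotics (s := SzaszEDF.C1 F f a) hm
    (SzaszEDF.C1_pos ha hF01 hmono hlim hF_neg hF_cont hf hf_cont hL)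
    (SzaszEDF.tendsto_szaszVarGain hX hF hF_cont hf hf' hf_cont hL hB ha)
    (SzaszEDF.tendsto_szaszSqBias hX hF hF_cont hf hf' hf_cont hL hB ha)
    (i := fun n => SzaszEDF.iG P X F f a (m n) n) (by
      filter_upwards [hmpos, eventually_gt_atTop 0] with n hmn hn
      unfold SzaszEDF.iG
      congr 1
      ext k
      refine and_congr_right fun hk => ?_
      rw [SzaszEDF.mise_edf hX hindep hF hF01 hF_cont hw hk,
        SzaszEDF.mise_szasz_eq hX hindep hF hF_cont hf hf' hf_cont hL hB ha hmn hn])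
  exact ⟨fun h => ⟨fun x hx h0 h1 => (hloc x hx h0 h1).1 h, hglob.1 h⟩,
    fun h h2 => ⟨fun x hx h0 h1 => (hloc x hx h0 h1).2.1 h h2, hglob.2.1 h h2⟩,
    fun c hc h => ⟨fun x hx h0 h1 => (hloc x hx h0 h1).2.2 c hc h, hglob.2.2 c hc h⟩⟩
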